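/- Let $M$ be a finite-dimensional $C^\infty$-manifold (Hausdorff, second countable, connected), let $\mathbb{T}\subseteq\mathbb{R}$ be an interval, and let $\mathcal{P}$ be a topological space. Fix a smooth Riemannian metric on $M$ and a smooth connection $\nabla$ on $TM$ compatible with it (e.g. the Levi-Civita connection). For a locally Lipschitz vector field $\xi$ on $M$ let $$\operatorname{dil}\xi(x)=\inf_{\mathcal{U}}\ \sup\{\|\nabla_{v}\xi\| : y\in\operatorname{cl}(\mathcal{U}),\ \xi\text{ differentiable at }y,\ v\in T_yM,\ \|v\|=1\},$$ the infimum being over relatively compact neighbourhoods $\mathcal{U}$ of $x$, and for compact $K\subseteq M$ let $$p^{\rm lip}_K(\xi)=\max\{\sup_{x\in K}\operatorname{dil}\xi(x),\ \sup_{x\in K}\|\xi(x)\|\}.$$ Let $X\in\Gamma^{\rm lip}_{\rm PLI}(\mathbb{T};TM;\mathcal{P})$, i.e. $X:\mathbb{T}\times M\times\mathcal{P}\to TM$ with $X(t,x,p)\in T_xM$ is such that, writing $X^p_t=X(t,\cdot,p)$: * for each $p\in\mathcal{P}$, $X^p_t$ is a locally Lipschitz vector field for every $t\in\mathbb{T}$,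 $t\mapsto X(t,x,p)$ is measurable for every $x\in M$, and $t\mapsto p^{\rm lip}_K(X^p_t)$ is integrable over $\mathbb{S}$ for all compact $K\subseteq M$ and $\mathbb{S}\subseteq\mathbb{T}$; * $p\mapsto X(t,x,p)$ is continuous for all $(t,x)\in\mathbb{T}\times M$; * for all $p_0\in\mathcal{P}$, compact $K\subseteq M$ and $\mathbb{S}\subseteq\mathbb{T}$, and $\varepsilon>0$ there is a neighbourhood $\mathcal{O}$ of $p_0$ with $\int_{\mathbb{S}}p^{\rm lip}_K(X^p_t-X^{p_0}_t)\,dt<\varepsilon$ for $p\in\mathcal{O}$. An integral curve of $X^p$ is a locally absolutely continuous curve $\gamma:J\to M$ on an interval $J\subseteq\mathbb{T}$ with $\gamma'(t)=X(t,\gamma(t),p)$ for almost every $t\in J$. Let $D_X$ be the set of $(t_1,t_0,x,p)\in\mathbb{T}\times\mathbb{T}\times M\times\mathcal{P}$ for which there is an integral curve $\gamma$ of $X^p$, on an interval containing $t_0$ and $t_1$, with $\gamma(t_0)=x$; the flow is $\Phi^X:D_X\to M$, $\Phi^X(t_1,t_0,x,p)=\gamma(t_1)$. Write $|t_0,t_1|$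 for the closed interval with endpoints $t_0$ and $t_1$. Let $K\subseteq M$ be compact, let $t_0,t_1\in\mathbb{T}$, and let $p_0\in\mathcal{P}$ be such that $$|t_0,t_1|\times\{t_0\}\times K\times\{p_0\}\subseteq D_X.$$ Then there exists a neighbourhood $\mathcal{O}\subseteq\mathcal{P}$ of $p_0$ such that $\Phi^X$ is well-defined on $|t_0,t_1|\times\{t_0\}\times K\times\mathcal{O}$ (that is, this set is contained in $D_X$, and the value of $\Phi^X$ there does not depend on the choice of the integral curve) and $$\bigcup_{(t,x,p)\in|t_0,t_1|\times K\times\mathcal{O}}\Phi^X(t,t_0,x,p)$$ is precompact (has compact closure) in $M$. -/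

import Mathlib

open Set Filter MeasureTheory Bundle
open scoped Manifold ContDiff Topology ENNReal

noncomputable section

namespace LipFlow

/-! ### The `C^lip` seminorms on vector fields

`M` is a manifold modelled on `E`, with a Riemannian metric (the `RiemannianBundle` structure on
the tangent spaces, whose norm is `‖·‖`) and a connection `cov` on `TM`; `cov ξ y v` is `∇_v ξ`. -/

section Seminorms

variable {E : Type*} [NormedAddCommGroup E] [NormedSpace ℝ E]
  {M : Type*} [TopologicalSpace M] [ChartedSpace E M] [IsManifold 𝓘(ℝ, E) ∞ M]

/-- A vector field is locally Lipschitz if, around every point, its representative in the chart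
at that point is Lipschitz. -/
def IsLocallyLipschitz (ξ : Π x : M, TangentSpace 𝓘(ℝ, E) x) : Prop :=
  ∀ x₀ : M, ∃ C : NNReal, ∃ s ∈ 𝓝 (extChartAt 𝓘(ℝ, E) x₀ x₀),
    LipschitzOnWith C
      (fun u : E => (trivializationAt E (TangentSpace 𝓘(ℝ, E) : M → Type _) x₀
        ⟨(extChartAt 𝓘(ℝ, E) x₀).symm u, ξ ((extChartAt 𝓘(ℝ, E) x₀).symm u)⟩).2) s

/-- The vector field `ξ`, as a map from `M` to `TM`, is differentiable at `y`. -/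
def IsDifferentiableAt (ξ : Π x : M, TangentSpace 𝓘(ℝ, E) x) (y : M) : Prop :=
  MDifferentiableAt 𝓘(ℝ, E) (𝓘(ℝ, E).prod 𝓘(ℝ, E))
    (fun x : M => (⟨x, ξ x⟩ : TangentBundle 𝓘(ℝ, E) M)) y

variable [RiemannianBundle (fun x : M => TangentSpace 𝓘(ℝ, E) x)]
  (cov : CovariantDerivative 𝓘(ℝ, E) E (TangentSpace 𝓘(ℝ, E) : M → Type _))

/-- The connection is compatible with the Riemannian metric:
`d⟨σ, τ⟩(v) = ⟨∇_v σ, τ⟩ + ⟨σ, ∇_v τ⟩`. -/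
def IsMetricConnection : Prop :=
  ∀ (σ τ : Π x : M, TangentSpace 𝓘(ℝ, E) x) (y : M),
    IsDifferentiableAt σ y → IsDifferentiableAt τ y → ∀ v : TangentSpace 𝓘(ℝ, E) y,
      mfderiv 𝓘(ℝ, E) 𝓘(ℝ, ℝ) (fun x => inner ℝ (σ x) (τ x)) y v =
        inner ℝ (cov σ y v) (τ y) + inner ℝ (σ y) (cov τ y v)

/-- The supremum of `‖∇_v ξ‖` over the unit tangent vectors `v` at the points of `s` at which `ξ`
is differentiable. -/
def supCovDeriv (ξ : Π x : M, TangentSpace 𝓘(ℝ, E) x) (s : Set M) : ℝ≥0∞ :=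
  ⨆ (y : M) (_ : y ∈ s) (_ : IsDifferentiableAt ξ y)
    (v : TangentSpace 𝓘(ℝ, E) y) (_ : ‖v‖ = 1), ‖cov ξ y v‖ₑ

/-- The local sectional dilatation of a (locally Lipschitz) vector field at `x`: the infimum of
`supCovDeriv` over the closures of the relatively compact neighbourhoods of `x`. -/
def dil (ξ : Π x : M, TangentSpace 𝓘(ℝ, E) x) (x : M) : ℝ≥0∞ :=
  ⨅ (U : Set M) (_ : U ∈ 𝓝 x) (_ : IsCompact (closure U)), supCovDeriv cov ξ (closure U)

/-- The `C^lip` seminorm of a vector field over `K`: the maximum of the suprema over `K` of the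
local sectional dilatation and of the norm. -/
def lipSeminorm (K : Set M) (ξ : Π x : M, TangentSpace 𝓘(ℝ, E) x) : ℝ≥0∞ :=
  max (⨆ x ∈ K, dil cov ξ x) (⨆ x ∈ K, ‖ξ x‖ₑ)

/-- Membership in `Γ^lip_LI(T; TM)`: the time-dependent vector field `ξ` (whose values at times
outside `T` play no role) is locally Lipschitz at each time, measurable in time, and its
`C^lip` seminorms are integrable over compact subsets of `T`. Measurability in time is asked
only pointwise on `M`, the weakest of the usual requirements. -/
structure IsLocIntegrablyBounded (T : Set ℝ) (ξ : ℝ → Π x : M, TangentSpace 𝓘(ℝ, E) x) :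
    Prop where
  lip : ∀ t ∈ T, IsLocallyLipschitz (ξ t)
  meas : ∀ x : M, AEStronglyMeasurable (fun t => ξ t x) (volume.restrict T)
  integrable : ∀ K : Set M, IsCompact K → ∀ S : Set ℝ, IsCompact S → S ⊆ T →
    AEMeasurable (fun t => lipSeminorm cov K (ξ t)) (volume.restrict S) ∧
      ∫⁻ t in S, lipSeminorm cov K (ξ t) < ⊤

/-- Membership in `Γ^lip_PLI(T; TM; P)`; `X p t x` is the value at time `t`, point `x` and
parameter `p`. Besides being in `Γ^lip_LI` for each parameter, `X` is continuous in the parameter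
for each time and point, and `p ↦ X p` is continuous for the topology of `Γ^lip_LI(T; TM)`, which
is given by the seminorms `ξ ↦ ∫_S lipSeminorm K (ξ t) dt`. -/
structure IsParamLocIntegrablyBounded {P : Type*} [TopologicalSpace P] (T : Set ℝ)
    (X : P → ℝ → Π x : M, TangentSpace 𝓘(ℝ, E) x) : Prop where
  locIntegrablyBounded : ∀ p, IsLocIntegrablyBounded cov T (X p)
  continuous_param : ∀ t ∈ T, ∀ x : M, Continuous (fun p => X p t x)
  continuous_seminorm : ∀ p₀ : P, ∀ K : Set M, IsCompact K → ∀ S : Set ℝ, IsCompact S → S ⊆ T →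
    ∀ ε : ℝ≥0∞, 0 < ε → ∃ O ∈ 𝓝 p₀, ∀ p ∈ O,
      AEMeasurable (fun t => lipSeminorm cov K (X p t - X p₀ t)) (volume.restrict S) ∧
        ∫⁻ t in S, lipSeminorm cov K (X p t - X p₀ t) < ε

end Seminorms

/-! ### Integral curves, intervals of existence and flows -/

section Flows

variable {E : Type*} [NormedAddCommGroup E] [NormedSpace ℝ E]
  {M : Type*} [TopologicalSpace M] [ChartedSpace E M]

variable (E) in
/-- A curve in `M`, defined on the interval `J`, is locally absolutely continuous if its
composition with every smooth function is absolutely continuous on every compact subinterval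
of `J`. -/
def IsLocallyAC (γ : ℝ → M) (J : Set ℝ) : Prop :=
  ∀ f : M → ℝ, ContMDiff 𝓘(ℝ, E) 𝓘(ℝ, ℝ) ∞ f →
    ∀ a ∈ J, ∀ b ∈ J, AbsolutelyContinuousOnInterval (f ∘ γ) a b

/-- `γ`, restricted to the interval `J ⊆ T`, is an integral curve of the time-dependent vector
field `ξ`. The values of `γ` outside `J` play no role. -/
structure IsIntegralCurve (T : Set ℝ) (ξ : ℝ → Π x : M, TangentSpace 𝓘(ℝ, E) x)
    (J : Set ℝ) (γ : ℝ → M) : Prop where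
  ordConnected : J.OrdConnected
  subset : J ⊆ T
  locallyAC : IsLocallyAC E γ J
  hasDeriv : ∀ᵐ t ∂(volume.restrict J),
    HasMFDerivWithinAt 𝓘(ℝ, ℝ) 𝓘(ℝ, E) γ J t ((1 : ℝ →L[ℝ] ℝ).smulRight (ξ t (γ t)))

variable {P : Type*}

/-- The interval of existence `J_X(t₀, x₀, p₀)`: the union of the intervals that carry an integral
curve of `X p₀` with value `x₀` at `t₀`. -/
def existenceInterval (T : Set ℝ) (X : P → ℝ → Π x : M, TangentSpace 𝓘(ℝ, E) x)
    (t₀ : ℝ) (x₀ : M) (p₀ : P) : Set ℝ :=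
  ⋃₀ {J | ∃ γ : ℝ → M, IsIntegralCurve T (X p₀) J γ ∧ t₀ ∈ J ∧ γ t₀ = x₀}

/-- The domain `D_X` of the flow, a set of quadruples `(t₁, t₀, x₀, p₀)`. -/
def flowDomain (T : Set ℝ) (X : P → ℝ → Π x : M, TangentSpace 𝓘(ℝ, E) x) :
    Set (ℝ × ℝ × M × P) :=
  {q | q.1 ∈ T ∧ q.2.1 ∈ T ∧ q.1 ∈ existenceInterval T X q.2.1 q.2.2.1 q.2.2.2}

open Classical in
/-- The flow `Φ^X(t₁, t₀, x₀, p₀)`: the value at `t₁` of an integral curve of `X p₀` that is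
defined on an interval containing `t₀` and `t₁` and has value `x₀` at `t₀`. Off the domain
`flowDomain T X` it has the irrelevant value `x₀`. -/
def flow (T : Set ℝ) (X : P → ℝ → Π x : M, TangentSpace 𝓘(ℝ, E) x)
    (t₁ t₀ : ℝ) (x₀ : M) (p₀ : P) : M :=
  if h : ∃ (γ : ℝ → M) (J : Set ℝ),
      IsIntegralCurve T (X p₀) J γ ∧ t₀ ∈ J ∧ t₁ ∈ J ∧ γ t₀ = x₀
  then h.choose t₁ else x₀

end Flows

end LipFlow

end

/-!
In a chart ball the `C^lip` seminorm bounds the representative of a vector field, because the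
connection differs from the coordinate derivative by a bounded zeroth-order term, and its Lipschitz
constant, because a locally Lipschitz map is differentiable almost everywhere (Rademacher) and the
almost everywhere bound on its derivative propagates along almost all translates of a segment.
Solving the Carathéodory equation in the chart by a contraction, on a time interval so short that
the integral of the bound is less than `1`, shows that for initial points and parameters near those
of a given integral curve the integral curve exists and stays close to the given one. This property
of pairs of times is transitive and holds for nearby times, so by connectedness of `|t₀, t₁|` it
holds for `t₀` and `t₁`. Compactness of `K` makes the neighbourhood of `p₀` uniform.
-/

noncomputable section

namespace LipFlow

section MeanValue

variable {F : Type*} [NormedAddCommGroup F] [NormedSpace ℝ F]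

theorem norm_sub_le_of_ae_hasDerivAt {g : ℝ → F} {C : NNReal} {a b L : ℝ}
    (hg : LipschitzOnWith C g (uIcc a b))
    (hL : ∀ᵐ t : ℝ, t ∈ uIoc a b → ∃ g', HasDerivAt g g' t ∧ ‖g'‖ ≤ L) :
    ‖g b - g a‖ ≤ L * |b - a| := by
  obtain ⟨φ, hφ, hφg⟩ := exists_dual_vector'' ℝ (g b - g a)
  have hac : AbsolutelyContinuousOnInterval (φ ∘ g) a b :=
    (φ.lipschitz.comp_lipschitzOnWith hg).absolutelyContinuousOnInterval
  have hφ_sub : ∫ t in a..b, deriv (φ ∘ g) t = ‖g b - g a‖ := by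
    rw [hac.integral_deriv_eq_sub, Function.comp_apply, Function.comp_apply, ← map_sub, hφg]
    rfl
  have hle : ‖∫ t in a..b, deriv (φ ∘ g) t‖ ≤ L * |b - a| := by
    refine intervalIntegral.norm_integral_le_of_norm_le_const_ae ?_
    filter_upwards [hL] with t ht hmem
    obtain ⟨g', hg', hb⟩ := ht hmem
    rw [(φ.hasFDerivAt.comp_hasDerivAt t hg').deriv]
    exact ((φ.le_of_opNorm_le hφ g').trans_eq (one_mul _)).trans hb
  simpa only [hφ_sub, norm_norm] using hle

theorem ae_ae_add_of_ae {E α : Type*} [AddCommGroup E] [MeasurableSpace E] [MeasurableAdd₂ E]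
    [MeasurableSpace α] {μ : Measure E} [SFinite μ] [μ.IsAddLeftInvariant] {ν : Measure α}
    [SFinite ν] {p : E → Prop} (hp : ∀ᵐ x ∂μ, p x) {c : α → E} (hc : Measurable c) :
    ∀ᵐ z ∂μ, ∀ᵐ t ∂ν, p (c t + z) := by
  obtain ⟨s, hsp, hs, hμs⟩ := exists_measurable_superset_of_null (ae_iff.1 hp)
  have hs_ae : ∀ᵐ x ∂μ, x ∉ s := measure_eq_zero_iff_ae_notMem.1 hμs
  have hae : ∀ᵐ z ∂μ, ∀ᵐ t ∂ν, c t + z ∉ s := by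
    refine (Measure.ae_ae_comm (p := fun z t => c t + z ∉ s) ?_).2
      (Eventually.of_forall fun t => (eventually_add_left_iff μ (c t)).2 hs_ae)
    exact (((hc.comp measurable_snd).add measurable_fst) hs).compl
  filter_upwards [hae] with z hz
  filter_upwards [hz] with t ht
  exact not_not.1 fun h => ht (hsp h)

variable {E : Type*} [NormedAddCommGroup E] [NormedSpace ℝ E] [FiniteDimensional ℝ E]

theorem lipschitzOnWith_of_ae_nnnorm_fderiv_le [MeasurableSpace E] [BorelSpace E]
    (μ : Measure E) [μ.IsAddHaarMeasure] {f : E → F} {U : Set E} (hUo : IsOpen U)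
    (hU : Convex ℝ U) {C L : NNReal} (hf : LipschitzOnWith C f U)
    (hL : ∀ᵐ x ∂μ, x ∈ U → DifferentiableAt ℝ f x ∧ ‖fderiv ℝ f x‖₊ ≤ L) :
    LipschitzOnWith L f U := by
  refine LipschitzOnWith.of_dist_le_mul fun u hu v hv => ?_
  let c : E → ℝ → E := fun z t => AffineMap.lineMap v u t + z
  have hc_deriv (z : E) (t : ℝ) : HasDerivAt (c z) (u - v) t :=
    AffineMap.hasDerivAt_lineMap.add_const z
  -- Almost every translate of the segment from `v` to `u` meets the exceptional set in a null set.
  have hae : ∀ᵐ z ∂μ, ∀ᵐ t : ℝ,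
      c z t ∈ U → DifferentiableAt ℝ f (c z t) ∧ ‖fderiv ℝ f (c z t)‖₊ ≤ L :=
    ae_ae_add_of_ae hL AffineMap.lineMap_continuous.measurable
  set G := {z : E | ∀ᵐ t : ℝ,
    c z t ∈ U → DifferentiableAt ℝ f (c z t) ∧ ‖fderiv ℝ f (c z t)‖₊ ≤ L}
  have hG : (𝓝[G] (0 : E)).NeBot :=
    mem_closure_iff_nhdsWithin_neBot.1 (Measure.dense_of_ae hae 0)
  have h_add (w : E) : Tendsto (fun z => w + z) (𝓝[G] 0) (𝓝 w) :=
    (Continuous.tendsto' (by fun_prop) 0 w (add_zero w)).mono_left nhdsWithin_le_nhds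
  have h_lim : Tendsto (fun z => ‖f (u + z) - f (v + z)‖) (𝓝[G] 0) (𝓝 (dist (f u) (f v))) := by
    rw [dist_eq_norm]
    exact (((hf.continuousOn.continuousAt (hUo.mem_nhds hu)).tendsto.comp (h_add u)).sub
      ((hf.continuousOn.continuousAt (hUo.mem_nhds hv)).tendsto.comp (h_add v))).norm
  refine le_of_tendsto h_lim ?_
  filter_upwards [h_add u (hUo.mem_nhds hu), h_add v (hUo.mem_nhds hv), self_mem_nhdsWithin]
    with z hzu hzv hzG
  have hcU : ∀ t ∈ uIcc (0 : ℝ) 1, c z t ∈ U := fun t ht => by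
    rw [uIcc_of_le zero_le_one] at ht
    simpa only [c, AffineMap.lineMap_apply_module', vadd_eq_add, add_sub_add_right_eq_sub,
      add_assoc] using hU.lineMap_mem hzv hzu ht
  have hc_lip : LipschitzWith ‖u - v‖₊ (c z) :=
    lipschitzWith_of_nnnorm_deriv_le (fun t => (hc_deriv z t).differentiableAt)
      fun t => (congrArg nnnorm (hc_deriv z t).deriv).le
  have h_le := norm_sub_le_of_ae_hasDerivAt (a := 0) (b := 1) (g := f ∘ c z)
    (L := L * ‖u - v‖) (hf.comp hc_lip.lipschitzOnWith hcU) <| by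
      filter_upwards [hzG] with t ht hmem
      obtain ⟨hd, hle⟩ := ht (hcU t (uIoc_subset_uIcc hmem))
      exact ⟨_, hd.hasFDerivAt.comp_hasDerivAt t (hc_deriv z t),
        (fderiv ℝ f (c z t)).le_of_opNorm_le hle _⟩
  simpa [c, dist_eq_norm] using h_le

theorem lipschitzOnWith_closedBall_of_nnnorm_fderiv_le [FiniteDimensional ℝ F] {f : E → F}
    {x₀ : E} {r : ℝ} (hr : r ≠ 0) {C L : NNReal}
    (hf : LipschitzOnWith C f (Metric.closedBall x₀ r))
    (hL : ∀ x ∈ Metric.ball x₀ r, DifferentiableAt ℝ f x → ‖fderiv ℝ f x‖₊ ≤ L) :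
    LipschitzOnWith L f (Metric.closedBall x₀ r) := by
  let _ : MeasurableSpace E := borel E
  have _ : BorelSpace E := ⟨rfl⟩
  have hf_ball := hf.mono Metric.ball_subset_closedBall
  rw [← closure_ball x₀ hr] at hf ⊢
  refine (lipschitzOnWith_closure_iff hf.continuousOn).2
    (lipschitzOnWith_of_ae_nnnorm_fderiv_le Measure.addHaar Metric.isOpen_ball
      (convex_ball x₀ r) hf_ball ?_)
  filter_upwards [hf_ball.ae_differentiableWithinAt_of_mem] with x hx hmem
  have hd := (hx hmem).differentiableAt (Metric.isOpen_ball.mem_nhds hmem)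
  exact ⟨hd, hL x hmem hd⟩

end MeanValue

section Measurability

theorem aestronglyMeasurable_comp_of_continuousOn {α E F : Type*} [MeasurableSpace α]
    [PseudoEMetricSpace E] [MeasurableSpace E] [OpensMeasurableSpace E] [TopologicalSpace F]
    [TopologicalSpace.PseudoMetrizableSpace F] {μ : Measure α} {f : α → E → F} {B : Set E}
    [TopologicalSpace.SeparableSpace B]
    (hmeas : ∀ x ∈ B, AEStronglyMeasurable (fun t => f t x) μ)
    (hcont : ∀ᵐ t ∂μ, ContinuousOn (f t) B) {u : α → E} (hu : Measurable u)
    (huB : ∀ t, u t ∈ B) : AEStronglyMeasurable (fun t => f t (u t)) μ := by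
  rcases isEmpty_or_nonempty α with hα | ⟨⟨t₀⟩⟩
  · exact .of_subsingleton_dom
  let q (n : ℕ) : SimpleFunc α E := SimpleFunc.approxOn u hu B (u t₀) (huB t₀) n
  have hqB (n : ℕ) (t : α) : q n t ∈ B := SimpleFunc.approxOn_mem hu (huB t₀) n t
  refine aestronglyMeasurable_of_tendsto_ae (u := atTop) (f := fun n t => f t (q n t))
    (fun n => ?_) ?_
  · have hcover : ⋃ y : (q n).range, q n ⁻¹' {(y : E)} = univ :=
      iUnion_eq_univ_iff.2 fun t => ⟨⟨q n t, (q n).mem_range_self t⟩, rfl⟩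
    rw [← Measure.restrict_univ (μ := μ), ← hcover, aestronglyMeasurable_iUnion_iff]
    rintro ⟨y, hy⟩
    obtain ⟨s, rfl⟩ := SimpleFunc.mem_range.1 hy
    refine (hmeas _ (hqB n s)).restrict.congr ?_
    filter_upwards [ae_restrict_mem ((q n).measurableSet_fiber (q n s))] with t ht
    exact congrArg (f t) ht.symm
  · filter_upwards [hcont] with t ht
    refine (ht (u t) (huB t)).tendsto.comp (tendsto_nhdsWithin_iff.2
      ⟨SimpleFunc.tendsto_approxOn hu (huB t₀) (subset_closure (huB t)), ?_⟩)
    exact Eventually.of_forall fun n => hqB n t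

end Measurability

section FixedPoint

variable {α X : Type*} [TopologicalSpace α] [MetricSpace X]

/-- The functions that are continuous on `s` and stay there within distance `ρ` of `c`; their
values off `s` are arbitrary. -/
def continuousTube (c : α → X) (ρ : ℝ) (s : Set α) : Set (α → X) :=
  {u | ContinuousOn u s ∧ ∀ t ∈ s, u t ∈ Metric.closedBall (c t) ρ}

theorem self_mem_continuousTube {c : α → X} {s : Set α} (hc : ContinuousOn c s) {ρ : ℝ}
    (hρ : 0 ≤ ρ) : c ∈ continuousTube c ρ s :=
  ⟨hc, fun _ _ => Metric.mem_closedBall_self hρ⟩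

theorem exists_eqOn_of_contracting [CompleteSpace X] {s : Set α} (hs : IsCompact s) {c : α → X}
    (hc : ContinuousOn c s) {ρ : ℝ} (hρ : 0 ≤ ρ) {q : NNReal} (hq : q < 1)
    {Φ : (α → X) → α → X} (hΦ : ∀ u ∈ continuousTube c ρ s, ContinuousOn (Φ u) s)
    (hΦq : ∀ u ∈ continuousTube c ρ s, ∀ v ∈ continuousTube c ρ s, ∀ D : ℝ, 0 ≤ D →
      (∀ t ∈ s, dist (u t) (v t) ≤ D) → ∀ t ∈ s, dist (Φ u t) (Φ v t) ≤ q * D)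
    (hΦc : ∀ t ∈ s, dist (Φ c t) (c t) ≤ (1 - q) * ρ) :
    ∃ u ∈ continuousTube c ρ s, EqOn (Φ u) u s := by
  classical
  have : CompactSpace s := isCompact_iff_compactSpace.1 hs
  let c' : C(s, X) := ⟨s.domRestrict c, hc.domRestrict⟩
  let S : Set C(s, X) := Metric.closedBall c' ρ
  let ext (u : C(s, X)) (t : α) : X := if h : t ∈ s then u ⟨t, h⟩ else c t
  have h_ext (u : C(s, X)) (t : s) : ext u t = u t := dif_pos t.2
  have ext_mem : ∀ u ∈ S, ext u ∈ continuousTube c ρ s := fun u hu => by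
    refine ⟨continuousOn_iff_continuous_domRestrict.2 ?_, fun t ht => ?_⟩
    · exact u.continuous.congr fun t => (h_ext u t).symm
    · rw [h_ext u ⟨t, ht⟩]
      exact (ContinuousMap.dist_le hρ).1 hu ⟨t, ht⟩
  have hc_mem := self_mem_continuousTube hc hρ
  let Ψ (u : S) : C(s, X) := ⟨s.domRestrict (Φ (ext u)), (hΦ _ (ext_mem u u.2)).domRestrict⟩
  have Ψ_mem (u : S) : Ψ u ∈ S := by
    refine (ContinuousMap.dist_le hρ).2 fun t => ?_
    have h_le := hΦq _ (ext_mem u u.2) c hc_mem ρ hρ (ext_mem u u.2).2 t t.2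
    calc dist (Φ (ext u) t) (c t) ≤ dist (Φ (ext u) t) (Φ c t) + dist (Φ c t) (c t) :=
          dist_triangle _ _ _
      _ ≤ q * ρ + (1 - q) * ρ := add_le_add h_le (hΦc t t.2)
      _ = ρ := by ring
  let Ψ' (u : S) : S := ⟨Ψ u, Ψ_mem u⟩
  have h_contr : ContractingWith q Ψ' := by
    refine ⟨hq, LipschitzWith.of_dist_le_mul fun u v => ?_⟩
    refine (ContinuousMap.dist_le (by positivity)).2 fun t => ?_
    refine hΦq _ (ext_mem u u.2) _ (ext_mem v v.2) _ dist_nonneg (fun r hr => ?_) t t.2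
    rw [h_ext u ⟨r, hr⟩, h_ext v ⟨r, hr⟩]
    exact ContinuousMap.dist_apply_le_dist _
  have : CompleteSpace S := Metric.isClosed_closedBall.completeSpace_coe
  have : Nonempty S := ⟨⟨c', Metric.mem_closedBall_self hρ⟩⟩
  let w : S := ContractingWith.fixedPoint Ψ' h_contr
  have hw : Ψ w = w := congrArg Subtype.val h_contr.fixedPoint_isFixedPt
  exact ⟨ext w, ext_mem w w.2, fun t ht =>
    (DFunLike.congr_fun hw ⟨t, ht⟩).trans (h_ext w ⟨t, ht⟩).symm⟩

end FixedPoint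

section Caratheodory

/-- The Carathéodory conditions for a time-dependent vector field `f` on `[a, b] × B`, with the
bound `m` and the Lipschitz constant `ℓ` depending on time. -/
structure IsCaratheodory {E : Type*} [NormedAddCommGroup E] (f : ℝ → E → E) (m ℓ : ℝ → ℝ≥0∞)
    (B : Set E) (a b : ℝ) : Prop where
  meas : ∀ x ∈ B, AEStronglyMeasurable (fun t => f t x) (volume.restrict (Icc a b))
  cont : ∀ t ∈ Icc a b, ContinuousOn (f t) B
  bound : ∀ t ∈ Icc a b, ∀ x ∈ B, ‖f t x‖ₑ ≤ m t
  lintegral_bound : ∫⁻ t in Icc a b, m t < ⊤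
  lip : ∀ t ∈ Icc a b, ∀ x ∈ B, ∀ y ∈ B, ‖f t x - f t y‖ₑ ≤ ℓ t * ‖x - y‖ₑ

theorem enorm_intervalIntegral_le_setLIntegral {E : Type*} [NormedAddCommGroup E]
    [NormedSpace ℝ E] {f : ℝ → E} {g : ℝ → ℝ≥0∞} {A : Set ℝ} (hA : A.OrdConnected)
    (hfg : ∀ r ∈ A, ‖f r‖ₑ ≤ g r) {s t : ℝ} (hs : s ∈ A) (ht : t ∈ A) :
    ‖∫ r in s..t, f r‖ₑ ≤ ∫⁻ r in A, g r := by
  have hsub : uIoc s t ⊆ A := uIoc_subset_uIcc.trans (hA.uIcc_subset hs ht)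
  calc ‖∫ r in s..t, f r‖ₑ = ‖∫ r in uIoc s t, f r‖ₑ := by
        rw [← ofReal_norm, intervalIntegral.norm_intervalIntegral_eq, ofReal_norm]
    _ ≤ ∫⁻ r in uIoc s t, ‖f r‖ₑ := enorm_integral_le_lintegral_enorm _
    _ ≤ ∫⁻ r in uIoc s t, g r := setLIntegral_mono' measurableSet_uIoc fun r hr => hfg r (hsub hr)
    _ ≤ ∫⁻ r in A, g r := lintegral_mono_set hsub

namespace IsCaratheodory

variable {E : Type*} [NormedAddCommGroup E] {f : ℝ → E → E} {m ℓ : ℝ → ℝ≥0∞} {B : Set E}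
  {a b : ℝ}

theorem integrableOn_comp (hf : IsCaratheodory f m ℓ B a b) {u : ℝ → E}
    (hu : ContinuousOn u (Icc a b)) (huB : MapsTo u (Icc a b) B) :
    IntegrableOn (fun t => f t (u t)) (Icc a b) := by
  rcases lt_or_ge b a with hba | hab
  · simp only [Icc_eq_empty_of_lt hba, integrableOn_empty]
  refine ⟨?_, (setLIntegral_mono' measurableSet_Icc
    fun t ht => hf.bound t ht _ (huB ht)).trans_lt hf.lintegral_bound⟩
  let _ : MeasurableSpace E := borel E
  have _ : BorelSpace E := ⟨rfl⟩
  let v : ℝ → E := IccExtend hab ((Icc a b).domRestrict u)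
  have hv : Continuous v := hu.domRestrict.Icc_extend' (h := hab)
  have hvB (t : ℝ) : v t ∈ u '' Icc a b := ⟨_, (projIcc a b hab t).2, rfl⟩
  have := (isCompact_Icc.image_of_continuousOn hu).isSeparable.separableSpace
  have h_meas := aestronglyMeasurable_comp_of_continuousOn (μ := volume.restrict (Icc a b))
    (fun x hx => hf.meas x (huB.image_subset hx)) ((ae_restrict_iff' measurableSet_Icc).2
      (Eventually.of_forall fun t ht => (hf.cont t ht).mono huB.image_subset)) hv.measurable hvB
  refine h_meas.congr ?_
  filter_upwards [ae_restrict_mem measurableSet_Icc] with t ht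
  exact congrArg (f t) (IccExtend_of_mem hab _ ht)

theorem intervalIntegrable_comp (hf : IsCaratheodory f m ℓ B a b) {u : ℝ → E}
    (hu : ContinuousOn u (Icc a b)) (huB : MapsTo u (Icc a b) B) {s t : ℝ} (hs : s ∈ Icc a b)
    (ht : t ∈ Icc a b) : IntervalIntegrable (fun t => f t (u t)) volume s t :=
  ((hf.integrableOn_comp hu huB).mono_set (ordConnected_Icc.uIcc_subset hs ht)).intervalIntegrable

variable [NormedSpace ℝ E]

theorem dist_integral_le (hf : IsCaratheodory f m ℓ B a b) {q : NNReal}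
    (hℓ : ∫⁻ t in Icc a b, ℓ t ≤ q) {u v : ℝ → E}
    (hu : ContinuousOn u (Icc a b)) (huB : MapsTo u (Icc a b) B)
    (hv : ContinuousOn v (Icc a b)) (hvB : MapsTo v (Icc a b) B) {s t : ℝ} (hs : s ∈ Icc a b)
    (ht : t ∈ Icc a b) {D : ℝ} (hD : 0 ≤ D) (huv : ∀ t ∈ Icc a b, dist (u t) (v t) ≤ D) :
    dist (∫ r in s..t, f r (u r)) (∫ r in s..t, f r (v r)) ≤ q * D := by
  lift D to NNReal using hD
  rw [dist_eq_norm, ← intervalIntegral.integral_sub (hf.intervalIntegrable_comp hu huB hs ht)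
    (hf.intervalIntegrable_comp hv hvB hs ht)]
  have h_le : ∀ r ∈ Icc a b, ‖f r (u r) - f r (v r)‖ₑ ≤ ℓ r * D := fun r hr =>
    (hf.lip r hr _ (huB hr) _ (hvB hr)).trans <| by
      gcongr
      rw [← edist_eq_enorm_sub, edist_nndist]
      exact_mod_cast huv r hr
  have h_int : ‖∫ r in s..t, (f r (u r) - f r (v r))‖ₑ ≤ q * D :=
    calc _ ≤ ∫⁻ r in Icc a b, ℓ r * D :=
          enorm_intervalIntegral_le_setLIntegral ordConnected_Icc h_le hs ht
      _ = (∫⁻ r in Icc a b, ℓ r) * D := lintegral_mul_const' _ _ ENNReal.coe_ne_top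
      _ ≤ q * D := by gcongr
  exact_mod_cast h_int

theorem eqOn_of_integral_eq (hf : IsCaratheodory f m ℓ B a b) {q : NNReal} (hq : q < 1)
    (hℓ : ∫⁻ t in Icc a b, ℓ t ≤ q) {u v : ℝ → E}
    (hu : ContinuousOn u (Icc a b)) (huB : MapsTo u (Icc a b) B)
    (hv : ContinuousOn v (Icc a b)) (hvB : MapsTo v (Icc a b) B) {s : ℝ} (hs : s ∈ Icc a b)
    {x : E} (hux : ∀ t ∈ Icc a b, u t = x + ∫ r in s..t, f r (u r))
    (hvx : ∀ t ∈ Icc a b, v t = x + ∫ r in s..t, f r (v r)) : EqOn u v (Icc a b) := by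
  obtain ⟨t₁, ht₁, hmax⟩ := isCompact_Icc.exists_isMaxOn ⟨s, hs⟩
    (continuous_dist.comp_continuousOn (hu.prodMk hv))
  have h_le : dist (u t₁) (v t₁) ≤ q * dist (u t₁) (v t₁) := by
    have h := hf.dist_integral_le hℓ hu huB hv hvB hs ht₁ dist_nonneg fun t ht => hmax ht
    rwa [← dist_add_left x, ← hux t₁ ht₁, ← hvx t₁ ht₁] at h
  have hq_real : (q : ℝ) < 1 := by exact_mod_cast hq
  have h_max : dist (u t₁) (v t₁) ≤ 0 := by
    nlinarith [hq_real, dist_nonneg (x := u t₁) (y := v t₁)]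
  exact fun t ht => dist_le_zero.1 ((hmax ht : dist (u t) (v t) ≤ _).trans h_max)

variable [CompleteSpace E]

theorem exists_solution_near (hf : IsCaratheodory f m ℓ B a b) {q : NNReal} (hq : q < 1)
    (hℓ : ∫⁻ t in Icc a b, ℓ t ≤ q) {c : ℝ → E} (hc : ContinuousOn c (Icc a b)) {ρ : ℝ}
    (hρ : 0 ≤ ρ) (hcB : ∀ t ∈ Icc a b, Metric.closedBall (c t) ρ ⊆ B) {s : ℝ}
    (hs : s ∈ Icc a b) {x : E}
    (hcx : ∀ t ∈ Icc a b, dist (x + ∫ r in s..t, f r (c r)) (c t) ≤ (1 - q) * ρ) :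
    ∃ u ∈ continuousTube c ρ (Icc a b), ∀ t ∈ Icc a b, u t = x + ∫ r in s..t, f r (u r) := by
  have h_maps {u : ℝ → E} (hu : u ∈ continuousTube c ρ (Icc a b)) : MapsTo u (Icc a b) B :=
    fun t ht => hcB t ht (hu.2 t ht)
  have h_cont : ∀ u ∈ continuousTube c ρ (Icc a b),
      ContinuousOn (fun t => x + ∫ r in s..t, f r (u r)) (Icc a b) := fun u hu => by
    have hab := hs.1.trans hs.2
    have h := intervalIntegral.continuousOn_primitive_interval' (hf.intervalIntegrable_comp hu.1
      (h_maps hu) (left_mem_Icc.2 hab) (right_mem_Icc.2 hab)) (Icc_subset_uIcc hs)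
    exact continuousOn_const.add (h.mono Icc_subset_uIcc)
  obtain ⟨u, hu, hu_eq⟩ := exists_eqOn_of_contracting isCompact_Icc hc hρ hq h_cont
    (fun u hu v hv D hD huv t ht => (dist_add_left _ _ _).trans_le <|
      hf.dist_integral_le hℓ hu.1 (h_maps hu) hv.1 (h_maps hv) hs ht hD huv) hcx
  exact ⟨u, hu, fun t ht => (hu_eq ht).symm⟩

theorem exists_solution_near_of_perturbation (hf : IsCaratheodory f m ℓ B a b) {q : NNReal}
    (hq : q < 1) (hℓ : ∫⁻ t in Icc a b, ℓ t ≤ q) {c g : ℝ → E}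
    (hc : ContinuousOn c (Icc a b)) (hg : IntegrableOn g (Icc a b)) {ρ δ : NNReal}
    (hcB : ∀ t ∈ Icc a b, Metric.closedBall (c t) ρ ⊆ B) {s : ℝ} (hs : s ∈ Icc a b)
    (hc_eq : ∀ t ∈ Icc a b, c t = c s + ∫ r in s..t, g r) {x : E}
    (hδ : ∫⁻ t in Icc a b, ‖f t (c t) - g t‖ₑ ≤ δ) (hx : dist x (c s) + δ ≤ (1 - q) * ρ) :
    ∃ u ∈ continuousTube c ρ (Icc a b), ∀ t ∈ Icc a b, u t = x + ∫ r in s..t, f r (u r) := by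
  have hcB' : MapsTo c (Icc a b) B := fun t ht => hcB t ht (Metric.mem_closedBall_self ρ.2)
  refine hf.exists_solution_near hq hℓ hc ρ.2 hcB hs fun t ht => ?_
  have h_int : dist (∫ r in s..t, f r (c r)) (∫ r in s..t, g r) ≤ δ := by
    rw [dist_eq_norm, ← intervalIntegral.integral_sub (hf.intervalIntegrable_comp hc hcB' hs ht)
      (hg.mono_set (ordConnected_Icc.uIcc_subset hs ht)).intervalIntegrable]
    exact_mod_cast (enorm_intervalIntegral_le_setLIntegral ordConnected_Icc
      (fun _ _ => le_rfl) hs ht).trans hδ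
  rw [hc_eq t ht]
  exact (dist_add_add_le _ _ _ _).trans ((add_le_add_right h_int _).trans hx)

end IsCaratheodory

end Caratheodory

section AbsoluteContinuity

theorem absolutelyContinuousOnInterval_of_dist_le {X Y : Type*} [PseudoMetricSpace X]
    [PseudoMetricSpace Y] {f : ℝ → X} {g : ℝ → Y} {a b : ℝ}
    (hg : AbsolutelyContinuousOnInterval g a b)
    (h : ∀ s ∈ uIcc a b, ∀ t ∈ uIcc a b, dist (f s) (f t) ≤ dist (g s) (g t)) :
    AbsolutelyContinuousOnInterval f a b := by
  rw [absolutelyContinuousOnInterval_iff] at hg ⊢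
  intro ε hε
  obtain ⟨δ, hδ, H⟩ := hg ε hε
  refine ⟨δ, hδ, fun I hI hlen => lt_of_le_of_lt ?_ (H I hI hlen)⟩
  exact Finset.sum_le_sum fun i hi => h _ (hI.1 i hi).1 _ (hI.1 i hi).2

theorem absolutelyContinuousOnInterval_comp_primitive {E X : Type*} [NormedAddCommGroup E]
    [NormedSpace ℝ E] [PseudoMetricSpace X] {g u : ℝ → E} {a b : ℝ}
    (hg : IntervalIntegrable g volume a b)
    (hu : ∀ s ∈ uIcc a b, ∀ t ∈ uIcc a b, u t - u s = ∫ r in s..t, g r) {F : E → X} {B : Set E}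
    {C : NNReal} (hF : LipschitzOnWith C F B) (huB : MapsTo u (uIcc a b) B) :
    AbsolutelyContinuousOnInterval (F ∘ u) a b := by
  have hg_norm : IntervalIntegrable (fun r => C * ‖g r‖) volume a b := hg.norm.const_mul _
  refine absolutelyContinuousOnInterval_of_dist_le
    (hg_norm.absolutelyContinuousOnInterval_intervalIntegral left_mem_uIcc) fun s hs t ht => ?_
  have hi {t : ℝ} (ht : t ∈ uIcc a b) : IntervalIntegrable (fun r => C * ‖g r‖) volume a t :=
    hg_norm.mono_set (uIcc_subset_uIcc left_mem_uIcc ht)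
  rw [dist_comm, dist_comm (∫ v in a..s, C * ‖g v‖), Real.dist_eq,
    intervalIntegral.integral_interval_sub_left (hi ht) (hi hs)]
  calc dist (F (u t)) (F (u s)) ≤ C * dist (u t) (u s) := hF.dist_le_mul _ (huB ht) _ (huB hs)
    _ = C * ‖∫ r in s..t, g r‖ := by rw [dist_eq_norm, hu s hs t ht]
    _ ≤ C * |∫ r in s..t, ‖g r‖| := by
      gcongr; exact intervalIntegral.norm_integral_le_abs_integral_norm
    _ = |∫ r in s..t, C * ‖g r‖| := by
      rw [intervalIntegral.integral_const_mul, abs_mul, abs_of_nonneg C.coe_nonneg]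

theorem absolutelyContinuousOnInterval_trans {f : ℝ → ℝ} {a b c : ℝ}
    (hab : AbsolutelyContinuousOnInterval f a b) (hbc : AbsolutelyContinuousOnInterval f b c) :
    AbsolutelyContinuousOnInterval f a c := by
  have i_ab := hab.intervalIntegrable_deriv
  have i_bc := hbc.intervalIntegrable_deriv
  have h_int : ∀ t ∈ uIcc a c, ∫ r in a..t, deriv f r = f t - f a := fun t ht => by
    rcases uIcc_subset_uIcc_union_uIcc ht with ht | ht
    · exact (hab.mono (uIcc_subset_uIcc_left ht)).integral_deriv_eq_sub
    · have hbt : uIcc b t ⊆ uIcc b c := uIcc_subset_uIcc_left ht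
      rw [← intervalIntegral.integral_add_adjacent_intervals i_ab (i_bc.mono_set hbt),
        hab.integral_deriv_eq_sub, (hbc.mono hbt).integral_deriv_eq_sub, add_comm,
        sub_add_sub_cancel]
  refine absolutelyContinuousOnInterval_of_dist_le
    ((i_ab.trans i_bc).absolutelyContinuousOnInterval_intervalIntegral left_mem_uIcc)
    fun s hs t ht => ?_
  rw [h_int s hs, h_int t ht, dist_sub_right]

end AbsoluteContinuity

section LipschitzNear

/-- `f` is Lipschitz on some neighbourhood of `u`. -/
def LipschitzNear {X Y : Type*} [PseudoEMetricSpace X] [PseudoEMetricSpace Y] (f : X → Y)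
    (u : X) : Prop :=
  ∃ C : NNReal, ∃ s ∈ 𝓝 u, LipschitzOnWith C f s

namespace LipschitzNear

section Metric

variable {X Y Z : Type*} [PseudoEMetricSpace X] [PseudoEMetricSpace Y] [PseudoEMetricSpace Z]

theorem continuousAt {f : X → Y} {u : X} (hf : LipschitzNear f u) : ContinuousAt f u := by
  obtain ⟨C, s, hs, h⟩ := hf
  exact h.continuousOn.continuousAt hs

theorem comp {g : Y → Z} {f : X → Y} {u : X} (hg : LipschitzNear g (f u))
    (hf : LipschitzNear f u) : LipschitzNear (g ∘ f) u := by
  have hfc := hf.continuousAt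
  obtain ⟨C, s, hs, h⟩ := hf
  obtain ⟨C', s', hs', h'⟩ := hg
  exact ⟨C' * C, s ∩ f ⁻¹' s', inter_mem hs (hfc hs'),
    h'.comp (h.mono inter_subset_left) fun x hx => hx.2⟩

theorem prodMk {f : X → Y} {g : X → Z} {u : X} (hf : LipschitzNear f u)
    (hg : LipschitzNear g u) : LipschitzNear (fun x => (f x, g x)) u := by
  obtain ⟨C, s, hs, h⟩ := hf
  obtain ⟨C', s', hs', h'⟩ := hg
  exact ⟨max C C', s ∩ s', inter_mem hs hs',
    (h.mono inter_subset_left).prodMk (h'.mono inter_subset_right)⟩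

theorem congr {f g : X → Y} {u : X} (hf : LipschitzNear f u) (hfg : f =ᶠ[𝓝 u] g) :
    LipschitzNear g u := by
  obtain ⟨C, s, hs, h⟩ := hf
  refine ⟨C, s ∩ {x | f x = g x}, inter_mem hs hfg, fun x hx y hy => ?_⟩
  rw [← hx.2, ← hy.2]
  exact h hx.1 hy.1

end Metric

theorem sub {X F : Type*} [PseudoEMetricSpace X] [NormedAddCommGroup F] {f g : X → F} {u : X}
    (hf : LipschitzNear f u) (hg : LipschitzNear g u) : LipschitzNear (f - g) u := by
  obtain ⟨C, s, hs, h⟩ := hf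
  obtain ⟨C', s', hs', h'⟩ := hg
  exact ⟨C + C', s ∩ s', inter_mem hs hs',
    (h.mono inter_subset_left).sub (h'.mono inter_subset_right)⟩

variable {E F G : Type*} [NormedAddCommGroup E] [NormedAddCommGroup F] [NormedSpace ℝ F]
  [NormedAddCommGroup G] [NormedSpace ℝ G]

theorem of_contDiffAt [NormedSpace ℝ E] {f : E → F} {u : E} (hf : ContDiffAt ℝ 1 f u) :
    LipschitzNear f u :=
  hf.exists_lipschitzOnWith

theorem clm_apply {X : Type*} [PseudoEMetricSpace X] {A : X → F →L[ℝ] G} {h : X → F} {u : X}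
    (hA : LipschitzNear A u) (hh : LipschitzNear h u) : LipschitzNear (fun x => A x (h x)) u :=
  comp (f := fun x => (A x, h x)) (g := fun q : (F →L[ℝ] G) × F => q.1 q.2)
    (of_contDiffAt isBoundedBilinearMap_apply.contDiff.contDiffAt) (hA.prodMk hh)

end LipschitzNear

end LipschitzNear

section ChartRep

variable {E : Type*} [NormedAddCommGroup E] [NormedSpace ℝ E]
  {M : Type*} [TopologicalSpace M] [ChartedSpace E M] {y₀ : M} {u : E}

theorem extChartAt_symm_mem_chartAt_source (hu : u ∈ (extChartAt 𝓘(ℝ, E) y₀).target) :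
    (extChartAt 𝓘(ℝ, E) y₀).symm u ∈ (chartAt E y₀).source :=
  extChartAt_source 𝓘(ℝ, E) y₀ ▸ (extChartAt 𝓘(ℝ, E) y₀).map_target hu

variable [IsManifold 𝓘(ℝ, E) ∞ M]

/-- The representative of the vector field `ξ` in the chart at `y₀` and the trivialization of `TM`
that this chart induces. Off the target of the chart its values are irrelevant. -/
def chartRep (y₀ : M) (ξ : Π x : M, TangentSpace 𝓘(ℝ, E) x) (u : E) : E :=
  (trivializationAt E (TangentSpace 𝓘(ℝ, E) : M → Type _) y₀
    ⟨(extChartAt 𝓘(ℝ, E) y₀).symm u, ξ ((extChartAt 𝓘(ℝ, E) y₀).symm u)⟩).2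

theorem chartRep_eq_continuousLinearMapAt (ξ : Π x : M, TangentSpace 𝓘(ℝ, E) x)
    (hu : u ∈ (extChartAt 𝓘(ℝ, E) y₀).target) :
    chartRep y₀ ξ u = (trivializationAt E (TangentSpace 𝓘(ℝ, E) : M → Type _)
      y₀).continuousLinearMapAt ℝ ((extChartAt 𝓘(ℝ, E) y₀).symm u)
        (ξ ((extChartAt 𝓘(ℝ, E) y₀).symm u)) := by
  rw [Trivialization.continuousLinearMapAt_apply,
    Trivialization.coe_linearMapAt_of_mem _ (extChartAt_symm_mem_chartAt_source hu)]
  rfl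

theorem chartRep_sub (ξ η : Π x : M, TangentSpace 𝓘(ℝ, E) x)
    (hu : u ∈ (extChartAt 𝓘(ℝ, E) y₀).target) :
    chartRep y₀ (ξ - η) u = chartRep y₀ ξ u - chartRep y₀ η u := by
  simp only [chartRep_eq_continuousLinearMapAt _ hu, Pi.sub_apply, map_sub]

theorem chartRep_eq_coordChangeL (ξ : Π x : M, TangentSpace 𝓘(ℝ, E) x) {y₁ : M}
    (hu : u ∈ (extChartAt 𝓘(ℝ, E) y₀).target)
    (hu₁ : (extChartAt 𝓘(ℝ, E) y₀).symm u ∈ (chartAt E y₁).source) :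
    chartRep y₀ ξ u =
      (trivializationAt E (TangentSpace 𝓘(ℝ, E) : M → Type _) y₁).coordChangeL ℝ
        (trivializationAt E (TangentSpace 𝓘(ℝ, E) : M → Type _) y₀)
        ((extChartAt 𝓘(ℝ, E) y₀).symm u)
        (chartRep y₁ ξ (extChartAt 𝓘(ℝ, E) y₁ ((extChartAt 𝓘(ℝ, E) y₀).symm u))) := by
  set e₀ := trivializationAt E (TangentSpace 𝓘(ℝ, E) : M → Type _) y₀
  set e₁ := trivializationAt E (TangentSpace 𝓘(ℝ, E) : M → Type _) y₁
  have h_inv : (extChartAt 𝓘(ℝ, E) y₁).symm (extChartAt 𝓘(ℝ, E) y₁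
      ((extChartAt 𝓘(ℝ, E) y₀).symm u)) = (extChartAt 𝓘(ℝ, E) y₀).symm u :=
    (extChartAt 𝓘(ℝ, E) y₁).left_inv (by rwa [extChartAt_source])
  rw [Trivialization.coordChangeL_apply e₁ e₀ ⟨hu₁, extChartAt_symm_mem_chartAt_source hu⟩,
    chartRep, chartRep, h_inv, e₁.symm_apply_apply_mk hu₁]

theorem isLocallyLipschitz_iff_lipschitzNear {ξ : Π x : M, TangentSpace 𝓘(ℝ, E) x} :
    IsLocallyLipschitz ξ ↔ ∀ x₀ : M, LipschitzNear (chartRep x₀ ξ) (extChartAt 𝓘(ℝ, E) x₀ x₀) :=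
  Iff.rfl

theorem IsLocallyLipschitz.sub {ξ η : Π x : M, TangentSpace 𝓘(ℝ, E) x}
    (hξ : IsLocallyLipschitz ξ) (hη : IsLocallyLipschitz η) : IsLocallyLipschitz (ξ - η) := by
  rw [isLocallyLipschitz_iff_lipschitzNear] at *
  refine fun x₀ => ((hξ x₀).sub (hη x₀)).congr ?_
  filter_upwards [extChartAt_target_mem_nhds (I := 𝓘(ℝ, E)) x₀] with u hu
  exact (chartRep_sub ξ η hu).symm

theorem IsLocallyLipschitz.lipschitzNear_chartRep {ξ : Π x : M, TangentSpace 𝓘(ℝ, E) x}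
    (hξ : IsLocallyLipschitz ξ) (hu : u ∈ (extChartAt 𝓘(ℝ, E) y₀).target) :
    LipschitzNear (chartRep y₀ ξ) u := by
  set y₁ := (extChartAt 𝓘(ℝ, E) y₀).symm u
  let e₀ := trivializationAt E (TangentSpace 𝓘(ℝ, E) : M → Type _) y₀
  let e₁ := trivializationAt E (TangentSpace 𝓘(ℝ, E) : M → Type _) y₁
  have hu_nhds := (isOpen_extChartAt_target (I := 𝓘(ℝ, E)) y₀).mem_nhds hu
  have h_symm : ContMDiffAt 𝓘(ℝ, E) 𝓘(ℝ, E) 1 (extChartAt 𝓘(ℝ, E) y₀).symm u :=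
    (contMDiffOn_extChartAt_symm y₀).contMDiffAt hu_nhds
  have h_chart : ContDiffAt ℝ 1
      (extChartAt 𝓘(ℝ, E) y₁ ∘ (extChartAt 𝓘(ℝ, E) y₀).symm) u :=
    contMDiffAt_iff_contDiffAt.1 (contMDiffAt_extChartAt.comp u h_symm)
  have h_coord : ContDiffAt ℝ 1
      (fun v => (e₁.coordChangeL ℝ e₀ ((extChartAt 𝓘(ℝ, E) y₀).symm v) : E →L[ℝ] E)) u := by
    have hmem : y₁ ∈ e₁.baseSet ∩ e₀.baseSet :=
      ⟨mem_chart_source E y₁, extChartAt_symm_mem_chartAt_source hu⟩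
    exact contMDiffAt_iff_contDiffAt.1 (((contMDiffOn_coordChangeL e₁ e₀).contMDiffAt
      ((e₁.open_baseSet.inter e₀.open_baseSet).mem_nhds hmem)).comp u h_symm)
  have h_rep : LipschitzNear (chartRep y₁ ξ ∘
      (extChartAt 𝓘(ℝ, E) y₁ ∘ (extChartAt 𝓘(ℝ, E) y₀).symm)) u :=
    .comp (isLocallyLipschitz_iff_lipschitzNear.1 hξ y₁) (.of_contDiffAt h_chart)
  refine ((LipschitzNear.of_contDiffAt h_coord).clm_apply h_rep).congr ?_
  filter_upwards [hu_nhds, h_symm.continuousAt ((chartAt E y₁).open_source.mem_nhds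
    (mem_chart_source E y₁))] with v hv hv₁
  exact (chartRep_eq_coordChangeL ξ hv hv₁).symm

end ChartRep

section CovariantDerivative

variable {E : Type*} [NormedAddCommGroup E] [NormedSpace ℝ E]
  {M : Type*} [TopologicalSpace M] [ChartedSpace E M] [IsManifold 𝓘(ℝ, E) ∞ M]
  (cov : CovariantDerivative 𝓘(ℝ, E) E (TangentSpace 𝓘(ℝ, E) : M → Type _))
  {ι : Type*} {y₀ y : M}

theorem isDifferentiableAt_sum_smul (s : Finset ι) {g : ι → Π x : M, TangentSpace 𝓘(ℝ, E) x}
    {h : ι → M → ℝ} (hg : ∀ i, IsDifferentiableAt (g i) y)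
    (hh : ∀ i, MDifferentiableAt 𝓘(ℝ, E) 𝓘(ℝ, ℝ) (h i) y) :
    IsDifferentiableAt (∑ i ∈ s, h i • g i) y :=
  Finset.sum_induction _ (IsDifferentiableAt · y) (fun _ _ => mdifferentiableAt_add_section)
    (mdifferentiableAt_zeroSection ..) fun i _ => MDifferentiableAt.smul_section (hh i) (hg i)

theorem cov_sum_smul (s : Finset ι) {g : ι → Π x : M, TangentSpace 𝓘(ℝ, E) x} {h : ι → M → ℝ}
    (hg : ∀ i, IsDifferentiableAt (g i) y)
    (hh : ∀ i, MDifferentiableAt 𝓘(ℝ, E) 𝓘(ℝ, ℝ) (h i) y) :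
    cov (∑ i ∈ s, h i • g i) y =
      ∑ i ∈ s, (h i y • cov (g i) y + (mvfderiv 𝓘(ℝ, E) (h i) y).smulRight (g i y)) := by
  classical
  induction s using Finset.induction_on with
  | empty => simp only [Finset.sum_empty, CovariantDerivative.zero, Pi.zero_apply]
  | insert a s ha ih =>
    have hd : IsDifferentiableAt (h a • g a) y := MDifferentiableAt.smul_section (hh a) (hg a)
    rw [Finset.sum_insert ha, Finset.sum_insert ha, ← ih,
      cov.isCovariantDerivativeOn.add hd (isDifferentiableAt_sum_smul s hg hh) (mem_univ y),
      cov.isCovariantDerivativeOn.leibniz (hg a) (hh a) (mem_univ y)]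

theorem chartRep_extChartAt (ξ : Π x : M, TangentSpace 𝓘(ℝ, E) x)
    (hy : y ∈ (chartAt E y₀).source) :
    chartRep y₀ ξ (extChartAt 𝓘(ℝ, E) y₀ y) =
      (trivializationAt E (TangentSpace 𝓘(ℝ, E) : M → Type _) y₀ ⟨y, ξ y⟩).2 := by
  rw [chartRep, (extChartAt 𝓘(ℝ, E) y₀).left_inv (by rwa [extChartAt_source])]

theorem isDifferentiableAt_of_chartRep (hy : y ∈ (chartAt E y₀).source)
    {ξ : Π x : M, TangentSpace 𝓘(ℝ, E) x}
    (hξ : DifferentiableAt ℝ (chartRep y₀ ξ) (extChartAt 𝓘(ℝ, E) y₀ y)) :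
    IsDifferentiableAt ξ y := by
  refine (Trivialization.mdifferentiableAt_section_iff 𝓘(ℝ, E)
    (trivializationAt E (TangentSpace 𝓘(ℝ, E) : M → Type _) y₀) ξ (b₀ := y) hy).2 ?_
  refine (hξ.mdifferentiableAt.comp y (mdifferentiableAt_extChartAt hy)).congr_of_eventuallyEq ?_
  filter_upwards [(chartAt E y₀).open_source.mem_nhds hy] with x hx
  exact (chartRep_extChartAt ξ hx).symm

/-- The endomorphism `w ↦ ∇_w ξ` of the tangent space at `y`, read in the trivialization of `TM`
at `y₀`. -/
def covInChart (y₀ : M) (ξ : Π x : M, TangentSpace 𝓘(ℝ, E) x) (y : M) : E →L[ℝ] E :=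
  ContinuousLinearMap.inCoordinates E (TangentSpace 𝓘(ℝ, E) : M → Type _) E
    (TangentSpace 𝓘(ℝ, E) : M → Type _) y₀ y y₀ y (cov ξ y)

/-- The connection term of `cov` in the trivialization of `TM` at `y₀`, that is
`w ↦ Γ(y)(w, v)` with the Christoffel symbols `Γ` of the local frame given by `b`. -/
def christoffel [Fintype ι] (b : Module.Basis ι ℝ E) (y₀ y : M) (v : E) : E →L[ℝ] E :=
  ∑ i, b.repr v i • covInChart cov y₀
    ((trivializationAt E (TangentSpace 𝓘(ℝ, E) : M → Type _) y₀).localFrame b i) y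

variable (b : Module.Basis ι ℝ E)

theorem continuousLinearMapAt_localFrame (i : ι) (hy : y ∈ (chartAt E y₀).source) :
    (trivializationAt E (TangentSpace 𝓘(ℝ, E) : M → Type _) y₀).continuousLinearMapAt ℝ y
      ((trivializationAt E (TangentSpace 𝓘(ℝ, E) : M → Type _) y₀).localFrame b i y) = b i := by
  let e := trivializationAt E (TangentSpace 𝓘(ℝ, E) : M → Type _) y₀
  have hye : y ∈ e.baseSet := hy
  rw [e.localFrame_apply_of_mem_baseSet b hye, Trivialization.continuousLinearMapAt_apply,
    Trivialization.coe_linearMapAt_of_mem _ hye]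
  exact (e.linearEquivAt ℝ y hye).apply_symm_apply (b i)

theorem eventually_eq_sum_repr_chartRep_smul_localFrame [Fintype ι]
    (ξ : Π x : M, TangentSpace 𝓘(ℝ, E) x)
    (hy : y ∈ (chartAt E y₀).source) :
    ∀ᶠ x in 𝓝 y, ξ x = (∑ i, (fun x => b.repr (chartRep y₀ ξ (extChartAt 𝓘(ℝ, E) y₀ x)) i) •
      (trivializationAt E (TangentSpace 𝓘(ℝ, E) : M → Type _) y₀).localFrame b i) x := by
  set e := trivializationAt E (TangentSpace 𝓘(ℝ, E) : M → Type _) y₀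
  filter_upwards [e.eventually_eq_localFrame_sum_coeff_smul (I := 𝓘(ℝ, E)) (b := b) (s := ξ) hy,
    (chartAt E y₀).open_source.mem_nhds hy] with x hx hx_source
  rw [hx, Finset.sum_apply]
  refine Finset.sum_congr rfl fun i _ => ?_
  rw [Pi.smul_apply', chartRep_extChartAt ξ hx_source,
    e.localFrameCoeff_eq_coeff (I := 𝓘(ℝ, E)) (b := b) hx_source]

variable [FiniteDimensional ℝ E]

theorem hasMFDerivAt_repr_chartRep (i : ι) (hy : y ∈ (chartAt E y₀).source)
    {ξ : Π x : M, TangentSpace 𝓘(ℝ, E) x}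
    (hξ : DifferentiableAt ℝ (chartRep y₀ ξ) (extChartAt 𝓘(ℝ, E) y₀ y)) :
    HasMFDerivAt 𝓘(ℝ, E) 𝓘(ℝ, ℝ)
      (fun x => b.repr (chartRep y₀ ξ (extChartAt 𝓘(ℝ, E) y₀ x)) i) y
      (((b.coord i).toContinuousLinearMap ∘L
        fderiv ℝ (chartRep y₀ ξ) (extChartAt 𝓘(ℝ, E) y₀ y)) ∘L
          mfderiv 𝓘(ℝ, E) 𝓘(ℝ, E) (extChartAt 𝓘(ℝ, E) y₀) y) :=
  HasMFDerivAt.comp (g := fun u => b.repr (chartRep y₀ ξ u) i) y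
    ((b.coord i).toContinuousLinearMap.hasFDerivAt.comp _ hξ.hasFDerivAt).hasMFDerivAt
    (mdifferentiableAt_extChartAt hy).hasMFDerivAt

theorem mvfderiv_repr_chartRep_symmL (i : ι) (hy : y ∈ (chartAt E y₀).source)
    {ξ : Π x : M, TangentSpace 𝓘(ℝ, E) x}
    (hξ : DifferentiableAt ℝ (chartRep y₀ ξ) (extChartAt 𝓘(ℝ, E) y₀ y)) (w : E) :
    mvfderiv 𝓘(ℝ, E) (fun x => b.repr (chartRep y₀ ξ (extChartAt 𝓘(ℝ, E) y₀ x)) i) y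
        ((trivializationAt E (TangentSpace 𝓘(ℝ, E) : M → Type _) y₀).symmL ℝ y w) =
      b.repr (fderiv ℝ (chartRep y₀ ξ) (extChartAt 𝓘(ℝ, E) y₀ y) w) i := by
  have h_symmL : mfderiv 𝓘(ℝ, E) 𝓘(ℝ, E) (extChartAt 𝓘(ℝ, E) y₀) y
      ((trivializationAt E (TangentSpace 𝓘(ℝ, E) : M → Type _) y₀).symmL ℝ y w) = w := by
    rw [← TangentBundle.continuousLinearMapAt_trivializationAt hy]
    exact Trivialization.continuousLinearMapAt_symmL _ hy w
  rw [mvfderiv, (hasMFDerivAt_repr_chartRep b i hy hξ).mfderiv]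
  exact congrArg (fun v => b.repr (fderiv ℝ (chartRep y₀ ξ) (extChartAt 𝓘(ℝ, E) y₀ y) v) i) h_symmL

theorem fderiv_chartRep [Fintype ι] (hy : y ∈ (chartAt E y₀).source)
    {ξ : Π x : M, TangentSpace 𝓘(ℝ, E) x}
    (hξ : DifferentiableAt ℝ (chartRep y₀ ξ) (extChartAt 𝓘(ℝ, E) y₀ y)) :
    fderiv ℝ (chartRep y₀ ξ) (extChartAt 𝓘(ℝ, E) y₀ y) =
      covInChart cov y₀ ξ y - christoffel cov b y₀ y (chartRep y₀ ξ (extChartAt 𝓘(ℝ, E) y₀ y)) := by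
  set e := trivializationAt E (TangentSpace 𝓘(ℝ, E) : M → Type _) y₀
  let h (i : ι) (x : M) : ℝ := b.repr (chartRep y₀ ξ (extChartAt 𝓘(ℝ, E) y₀ x)) i
  have h_frame (i : ι) : IsDifferentiableAt (e.localFrame b i) y :=
    ((e.contMDiffOn_localFrame_baseSet 1 b i).contMDiffAt
      (e.open_baseSet.mem_nhds hy)).mdifferentiableAt one_ne_zero
  have h_coeff (i : ι) : MDifferentiableAt 𝓘(ℝ, E) 𝓘(ℝ, ℝ) (h i) y :=
    (hasMFDerivAt_repr_chartRep b i hy hξ).mdifferentiableAt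
  have h_cov : cov ξ y = ∑ i, (h i y • cov (e.localFrame b i) y +
      (mvfderiv 𝓘(ℝ, E) (h i) y).smulRight (e.localFrame b i y)) := by
    rw [← cov_sum_smul cov Finset.univ h_frame h_coeff]
    exact cov.isCovariantDerivativeOn.congr_of_eventuallyEq (isDifferentiableAt_of_chartRep hy hξ)
      (isDifferentiableAt_sum_smul _ h_frame h_coeff) univ_mem
      (eventually_eq_sum_repr_chartRep_smul_localFrame b ξ hy)
  ext w
  have h_repr := b.sum_repr (fderiv ℝ (chartRep y₀ ξ) (extChartAt 𝓘(ℝ, E) y₀ y) w)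
  have h_term (i : ι) : e.continuousLinearMapAt ℝ y ((h i y • cov (e.localFrame b i) y +
        (mvfderiv 𝓘(ℝ, E) (h i) y).smulRight (e.localFrame b i y)) (e.symmL ℝ y w)) =
      h i y • covInChart cov y₀ (e.localFrame b i) y w +
        b.repr (fderiv ℝ (chartRep y₀ ξ) (extChartAt 𝓘(ℝ, E) y₀ y) w) i • b i := by
    rw [add_apply, map_add, smul_apply, ContinuousLinearMap.smulRight_apply, map_smul, map_smul,
      mvfderiv_repr_chartRep_symmL b i hy hξ w, continuousLinearMapAt_localFrame b i hy]
    rfl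
  have h_covInChart : covInChart cov y₀ ξ y w =
      ∑ i, h i y • covInChart cov y₀ (e.localFrame b i) y w +
        fderiv ℝ (chartRep y₀ ξ) (extChartAt 𝓘(ℝ, E) y₀ y) w := by
    change e.continuousLinearMapAt ℝ y (cov ξ y (e.symmL ℝ y w)) = _
    rw [h_cov, sum_apply, map_sum, ← h_repr, ← Finset.sum_add_distrib]
    exact Finset.sum_congr rfl fun i _ => h_term i
  rw [sub_apply, h_covInChart, christoffel, sum_apply]
  exact (add_sub_cancel_left _ _).symm

variable [T2Space M]

theorem exists_contMDiff_eventuallyEq_localFrame (i : ι) (y₀ : M) :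
    ∃ g : Π x : M, TangentSpace 𝓘(ℝ, E) x,
      ContMDiff 𝓘(ℝ, E) (𝓘(ℝ, E).prod 𝓘(ℝ, E)) ∞
        (fun x => (⟨x, g x⟩ : TangentBundle 𝓘(ℝ, E) M)) ∧
      ∀ᶠ y in 𝓝 y₀, g y =
        (trivializationAt E (TangentSpace 𝓘(ℝ, E) : M → Type _) y₀).localFrame b i y := by
  let e := trivializationAt E (TangentSpace 𝓘(ℝ, E) : M → Type _) y₀
  obtain ⟨ψ⟩ := (inferInstance : Nonempty (SmoothBumpFunction 𝓘(ℝ, E) y₀))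
  refine ⟨(ψ : M → ℝ) • e.localFrame b i, ?_, ?_⟩
  · exact ContMDiffOn.smul_section_of_tsupport ψ.contMDiff.contMDiffOn (chartAt E y₀).open_source
      ψ.tsupport_subset_chartAt_source (e.contMDiffOn_localFrame_baseSet ∞ b i)
  · filter_upwards [ψ.eventuallyEq_one] with y hy
    rw [Pi.smul_apply', hy, Pi.one_apply, one_smul]

theorem continuousAt_covInChart_localFrame {k : ℕ∞}
    [CovariantDerivative.ContMDiffCovariantDerivative cov k] (i : ι) (y₀ : M) :
    ContinuousAt (covInChart cov y₀
      ((trivializationAt E (TangentSpace 𝓘(ℝ, E) : M → Type _) y₀).localFrame b i)) y₀ := by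
  set e := trivializationAt E (TangentSpace 𝓘(ℝ, E) : M → Type _) y₀
  -- `cov` is only known to be smooth on globally defined vector fields.
  obtain ⟨g, hg, hg_eq⟩ := exists_contMDiff_eventuallyEq_localFrame b i y₀
  have h_smooth := (CovariantDerivative.ContMDiffCovariantDerivative.contMDiff
    (cov := cov) (k := k)).contMDiff (σ := g) (hg.of_le (by exact_mod_cast le_top)).contMDiffOn
  have h_cont : ContinuousAt (covInChart cov y₀ g) y₀ :=
    ((contMDiffAt_hom_bundle _).1 (h_smooth.contMDiffAt univ_mem)).2.continuousAt
  refine h_cont.congr ?_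
  filter_upwards [hg_eq.eventually_nhds, (chartAt E y₀).open_source.mem_nhds
    (mem_chart_source E y₀)] with y hy hy_source
  have h_frame : IsDifferentiableAt (e.localFrame b i) y :=
    ((e.contMDiffOn_localFrame_baseSet 1 b i).contMDiffAt
      (e.open_baseSet.mem_nhds hy_source)).mdifferentiableAt one_ne_zero
  rw [covInChart, covInChart, cov.isCovariantDerivativeOn.congr_of_eventuallyEq
    (hg.mdifferentiable (by simp) y) h_frame univ_mem hy]

theorem exists_eventually_norm_christoffel_le [Fintype ι] {k : ℕ∞}
    [CovariantDerivative.ContMDiffCovariantDerivative cov k] (y₀ : M) :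
    ∃ c : NNReal, ∀ᶠ y in 𝓝 y₀, ∀ v, ‖christoffel cov b y₀ y v‖ ≤ c * ‖v‖ := by
  set e := trivializationAt E (TangentSpace 𝓘(ℝ, E) : M → Type _) y₀
  let c (y : M) : NNReal :=
    ∑ i, ‖(b.coord i).toContinuousLinearMap‖₊ * ‖covInChart cov y₀ (e.localFrame b i) y‖₊
  have hc : ContinuousAt c y₀ := tendsto_finsetSum _ fun i _ =>
    (continuousAt_covInChart_localFrame cov b (k := k) i y₀).nnnorm.const_mul _
  refine ⟨c y₀ + 1, ?_⟩
  filter_upwards [hc.eventually_lt continuousAt_const (lt_add_one (c y₀))] with y hy v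
  calc ‖christoffel cov b y₀ y v‖
      ≤ ∑ i, ‖b.repr v i • covInChart cov y₀ (e.localFrame b i) y‖ := norm_sum_le _ _
    _ ≤ ∑ i, ‖(b.coord i).toContinuousLinearMap‖ * ‖v‖ *
          ‖covInChart cov y₀ (e.localFrame b i) y‖ := by
        refine Finset.sum_le_sum fun i _ => ?_
        rw [norm_smul]
        gcongr
        exact (b.coord i).toContinuousLinearMap.le_opNorm v
    _ = c y * ‖v‖ := by
        simp only [c, NNReal.coe_sum, NNReal.coe_mul, coe_nnnorm, Finset.sum_mul]
        exact Finset.sum_congr rfl fun i _ => mul_right_comm _ _ _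
    _ ≤ (c y₀ + 1 : NNReal) * ‖v‖ := by gcongr

end CovariantDerivative

section ChartBall

variable {E : Type*} [NormedAddCommGroup E] [NormedSpace ℝ E]
  {M : Type*} [TopologicalSpace M] [ChartedSpace E M] {y₀ : M} {r : ℝ} {u : E}

variable (E) in
/-- The part of `M` that the chart at `y₀` maps to the closed ball of radius `r` about the image
of `y₀`. -/
def chartBall (y₀ : M) (r : ℝ) : Set M :=
  (chartAt E y₀).source ∩
    extChartAt 𝓘(ℝ, E) y₀ ⁻¹' Metric.closedBall (extChartAt 𝓘(ℝ, E) y₀ y₀) r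

theorem chartBall_mem_nhds (y₀ : M) (hr : 0 < r) : chartBall E y₀ r ∈ 𝓝 y₀ :=
  inter_mem (chart_source_mem_nhds E y₀)
    (continuousAt_extChartAt y₀ (Metric.closedBall_mem_nhds _ hr))

theorem chartBall_mono {r' : ℝ} (h : r ≤ r') : chartBall E y₀ r ⊆ chartBall E y₀ r' :=
  inter_subset_inter_right _ (preimage_mono (Metric.closedBall_subset_closedBall h))

theorem symm_mem_chartBall (hu : u ∈ Metric.closedBall (extChartAt 𝓘(ℝ, E) y₀ y₀) r)
    (hu_target : u ∈ (extChartAt 𝓘(ℝ, E) y₀).target) :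
    (extChartAt 𝓘(ℝ, E) y₀).symm u ∈ chartBall E y₀ r :=
  ⟨extChartAt_symm_mem_chartAt_source hu_target, by
    rwa [mem_preimage, (extChartAt 𝓘(ℝ, E) y₀).right_inv hu_target]⟩

theorem symm_extChartAt_of_mem_chartBall {y : M} (hy : y ∈ chartBall E y₀ r) :
    (extChartAt 𝓘(ℝ, E) y₀).symm (extChartAt 𝓘(ℝ, E) y₀ y) = y :=
  (extChartAt 𝓘(ℝ, E) y₀).left_inv (by simpa only [extChartAt_source] using hy.1)

theorem isCompact_chartBall [FiniteDimensional ℝ E]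
    (hr : Metric.closedBall (extChartAt 𝓘(ℝ, E) y₀ y₀) r ⊆ (extChartAt 𝓘(ℝ, E) y₀).target) :
    IsCompact (chartBall E y₀ r) := by
  have := FiniteDimensional.proper_real E
  have h_image : chartBall E y₀ r = (extChartAt 𝓘(ℝ, E) y₀).symm ''
      Metric.closedBall (extChartAt 𝓘(ℝ, E) y₀ y₀) r :=
    Subset.antisymm (fun y hy => ⟨_, hy.2, symm_extChartAt_of_mem_chartBall hy⟩)
      (image_subset_iff.2 fun u hu => symm_mem_chartBall hu (hr hu))
  rw [h_image]
  exact (isCompact_closedBall _ _).image_of_continuousOn ((continuousOn_extChartAt_symm y₀).mono hr)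

theorem exists_forall_mem_chartBall {p : M → Prop} (hp : ∀ᶠ y in 𝓝 y₀, p y) :
    ∃ r > 0, Metric.closedBall (extChartAt 𝓘(ℝ, E) y₀ y₀) (2 * r) ⊆
      (extChartAt 𝓘(ℝ, E) y₀).target ∧ ∀ y ∈ chartBall E y₀ r, p y := by
  have h_tendsto : Tendsto (extChartAt 𝓘(ℝ, E) y₀).symm (𝓝 (extChartAt 𝓘(ℝ, E) y₀ y₀)) (𝓝 y₀) := by
    simpa only [ContinuousAt, extChartAt_to_inv] using
      continuousAt_extChartAt_symm (I := 𝓘(ℝ, E)) y₀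
  obtain ⟨R, hR, h_ball⟩ := Metric.nhds_basis_closedBall.mem_iff.1
    (inter_mem (extChartAt_target_mem_nhds (I := 𝓘(ℝ, E)) y₀) (h_tendsto.eventually hp))
  refine ⟨R / 2, half_pos hR, fun u hu => (h_ball (by rwa [mul_div_cancel₀ R two_ne_zero] at hu)).1,
    fun y hy => ?_⟩
  rw [← symm_extChartAt_of_mem_chartBall hy]
  exact (h_ball (Metric.closedBall_subset_closedBall (half_le_self hR.le) hy.2)).2

theorem IsLocallyLipschitz.lipschitzOnWith_chartRep [FiniteDimensional ℝ E]
    [IsManifold 𝓘(ℝ, E) ∞ M] {ξ : Π x : M, TangentSpace 𝓘(ℝ, E) x} (hξ : IsLocallyLipschitz ξ)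
    (hr : r ≠ 0)
    (hr_target : Metric.closedBall (extChartAt 𝓘(ℝ, E) y₀ y₀) r ⊆ (extChartAt 𝓘(ℝ, E) y₀).target)
    {L : NNReal} (hL : ∀ y ∈ chartBall E y₀ r,
      DifferentiableAt ℝ (chartRep y₀ ξ) (extChartAt 𝓘(ℝ, E) y₀ y) →
        ‖fderiv ℝ (chartRep y₀ ξ) (extChartAt 𝓘(ℝ, E) y₀ y)‖₊ ≤ L) :
    LipschitzOnWith L (chartRep y₀ ξ) (Metric.closedBall (extChartAt 𝓘(ℝ, E) y₀ y₀) r) := by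
  have := FiniteDimensional.proper_real E
  have h_loc : LocallyLipschitzOn (Metric.closedBall (extChartAt 𝓘(ℝ, E) y₀ y₀) r)
      (chartRep y₀ ξ) := fun u hu =>
    let ⟨c, s, hs, h⟩ := hξ.lipschitzNear_chartRep (hr_target hu)
    ⟨c, s, nhdsWithin_le_nhds hs, h⟩
  obtain ⟨c, hc⟩ := h_loc.exists_lipschitzOnWith_of_compact (isCompact_closedBall _ _)
  refine lipschitzOnWith_closedBall_of_nnnorm_fderiv_le hr hc fun u hu h_diff => ?_
  have hu' := Metric.ball_subset_closedBall hu
  have h := hL _ (symm_mem_chartBall hu' (hr_target hu'))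
  rw [(extChartAt 𝓘(ℝ, E) y₀).right_inv (hr_target hu')] at h
  exact h h_diff

end ChartBall

section ChartEstimate

variable {E : Type*} [NormedAddCommGroup E] [NormedSpace ℝ E]
  {M : Type*} [TopologicalSpace M] [ChartedSpace E M] [IsManifold 𝓘(ℝ, E) ∞ M]
  [RiemannianBundle (fun x : M => TangentSpace 𝓘(ℝ, E) x)]
  (cov : CovariantDerivative 𝓘(ℝ, E) E (TangentSpace 𝓘(ℝ, E) : M → Type _))
  {ξ : Π x : M, TangentSpace 𝓘(ℝ, E) x}

theorem enorm_le_lipSeminorm {K : Set M} {y : M} (hy : y ∈ K)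
    (ξ : Π x : M, TangentSpace 𝓘(ℝ, E) x) : ‖ξ y‖ₑ ≤ lipSeminorm cov K ξ :=
  (le_iSup₂ (f := fun x (_ : x ∈ K) => ‖ξ x‖ₑ) y hy).trans (le_max_right _ _)

theorem enorm_cov_le_lipSeminorm {K : Set M} {y : M} (hy : y ∈ K) (hξ : IsDifferentiableAt ξ y)
    {v : TangentSpace 𝓘(ℝ, E) y} (hv : ‖v‖ = 1) : ‖cov ξ y v‖ₑ ≤ lipSeminorm cov K ξ :=
  calc ‖cov ξ y v‖ₑ ≤ dil cov ξ y := le_iInf₂ fun _ hU => le_iInf fun _ =>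
        le_iSup_of_le y <| le_iSup_of_le (subset_closure (mem_of_mem_nhds hU)) <|
          le_iSup_of_le hξ <| le_iSup_of_le v <| le_iSup_of_le hv le_rfl
    _ ≤ ⨆ x ∈ K, dil cov ξ x := le_iSup₂ (f := fun x (_ : x ∈ K) => dil cov ξ x) y hy
    _ ≤ lipSeminorm cov K ξ := le_max_left _ _

theorem nnnorm_cov_apply_le {K : Set M} {y : M} (hy : y ∈ K) (hξ : IsDifferentiableAt ξ y)
    {L : NNReal} (hL : lipSeminorm cov K ξ ≤ L) (v : TangentSpace 𝓘(ℝ, E) y) :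
    ‖cov ξ y v‖₊ ≤ L * ‖v‖₊ := by
  rcases eq_or_ne v 0 with rfl | hv
  · simp only [map_zero, nnnorm_zero, mul_zero, le_refl]
  have h_unit : ‖(‖v‖⁻¹ • v)‖ = 1 := norm_smul_inv_norm hv
  have h_le : ‖cov ξ y (‖v‖⁻¹ • v)‖₊ ≤ L := by
    exact_mod_cast (enorm_cov_le_lipSeminorm cov hy hξ h_unit).trans hL
  rwa [map_smul, nnnorm_smul, nnnorm_inv, nnnorm_norm,
    inv_mul_le_iff₀ (nnnorm_pos.2 hv), mul_comm] at h_le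

/-- On the chart ball of radius `r` about `y₀`, the seminorm `lipSeminorm` bounds, up to the factor
`C`, the size of the representative of a vector field and the Lipschitz constant of that of a
locally Lipschitz one. The ball of twice the radius is asked to lie in the chart as well, which
leaves room for a bump function that equals `1` on the chart ball. -/
structure IsChartEstimate (y₀ : M) (r : ℝ) (C : NNReal) : Prop where
  pos : 0 < r
  closedBall_subset : Metric.closedBall (extChartAt 𝓘(ℝ, E) y₀ y₀) (2 * r) ⊆
    (extChartAt 𝓘(ℝ, E) y₀).target
  enorm_chartRep_le : ∀ ξ : Π x : M, TangentSpace 𝓘(ℝ, E) x,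
    ∀ u ∈ Metric.closedBall (extChartAt 𝓘(ℝ, E) y₀ y₀) r,
      ‖chartRep y₀ ξ u‖ₑ ≤ C * lipSeminorm cov (chartBall E y₀ r) ξ
  enorm_chartRep_sub_le : ∀ ξ : Π x : M, TangentSpace 𝓘(ℝ, E) x, IsLocallyLipschitz ξ →
    ∀ u ∈ Metric.closedBall (extChartAt 𝓘(ℝ, E) y₀ y₀) r,
    ∀ v ∈ Metric.closedBall (extChartAt 𝓘(ℝ, E) y₀ y₀) r,
      ‖chartRep y₀ ξ u - chartRep y₀ ξ v‖ₑ ≤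
        C * lipSeminorm cov (chartBall E y₀ r) ξ * ‖u - v‖ₑ

variable {cov} in
theorem IsChartEstimate.closedBall_subset_target {y₀ : M} {r : ℝ} {C : NNReal}
    (h : IsChartEstimate cov y₀ r C) :
    Metric.closedBall (extChartAt 𝓘(ℝ, E) y₀ y₀) r ⊆ (extChartAt 𝓘(ℝ, E) y₀).target :=
  (Metric.closedBall_subset_closedBall (by linarith [h.pos])).trans h.closedBall_subset

/-- Every point of `M` has a chart ball on which `lipSeminorm` controls representatives of vector
fields. This is all that the flow of a time-dependent vector field uses of the Riemannian metric
and of the connection. -/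
def HasChartEstimates : Prop :=
  ∀ y₀ : M, ∃ (r : ℝ) (C : NNReal), IsChartEstimate cov y₀ r C

variable [IsContinuousRiemannianBundle E (fun x : M => TangentSpace 𝓘(ℝ, E) x)]

theorem exists_eventually_nnnorm_chartRep_le (y₀ : M) :
    ∃ C : NNReal, ∀ᶠ y in 𝓝 y₀, ∀ ξ : Π x : M, TangentSpace 𝓘(ℝ, E) x,
      ‖chartRep y₀ ξ (extChartAt 𝓘(ℝ, E) y₀ y)‖₊ ≤ C * ‖ξ y‖₊ := by
  obtain ⟨C, hC, h_triv⟩ :=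
    eventually_norm_trivializationAt_lt E (fun x : M => TangentSpace 𝓘(ℝ, E) x) y₀
  lift C to NNReal using hC.le
  refine ⟨C, ?_⟩
  filter_upwards [h_triv, chart_source_mem_nhds E y₀] with y hy hy_source ξ
  have hy_source' : y ∈ (extChartAt 𝓘(ℝ, E) y₀).source := by rwa [extChartAt_source]
  rw [chartRep_eq_continuousLinearMapAt ξ ((extChartAt 𝓘(ℝ, E) y₀).map_source hy_source'),
    (extChartAt 𝓘(ℝ, E) y₀).left_inv hy_source']
  exact (ContinuousLinearMap.le_opNNNorm _ _).trans (by gcongr; exact_mod_cast hy.le)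

theorem exists_eventually_nnnorm_covInChart_le (y₀ : M) :
    ∃ C : NNReal, ∀ᶠ y in 𝓝 y₀, ∀ (ξ : Π x : M, TangentSpace 𝓘(ℝ, E) x) (L : NNReal),
      (∀ v, ‖cov ξ y v‖₊ ≤ L * ‖v‖₊) → ‖covInChart cov y₀ ξ y‖₊ ≤ C * L := by
  obtain ⟨C₁, hC₁, h_triv⟩ :=
    eventually_norm_trivializationAt_lt E (fun x : M => TangentSpace 𝓘(ℝ, E) x) y₀
  obtain ⟨C₂, hC₂, h_symm⟩ :=
    eventually_norm_symmL_trivializationAt_lt E (fun x : M => TangentSpace 𝓘(ℝ, E) x) y₀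
  lift C₁ to NNReal using hC₁.le
  lift C₂ to NNReal using hC₂.le
  refine ⟨C₁ * C₂, ?_⟩
  filter_upwards [h_triv, h_symm] with y hy₁ hy₂ ξ L hL
  refine ContinuousLinearMap.opNNNorm_le_bound _ _ fun w => ?_
  set e := trivializationAt E (TangentSpace 𝓘(ℝ, E) : M → Type _) y₀
  calc ‖covInChart cov y₀ ξ y w‖₊
      = ‖e.continuousLinearMapAt ℝ y (cov ξ y (e.symmL ℝ y w))‖₊ := rfl
    _ ≤ C₁ * (L * (C₂ * ‖w‖₊)) := by
      refine (ContinuousLinearMap.le_opNNNorm _ _).trans ?_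
      gcongr
      · exact_mod_cast hy₁.le
      · refine (hL _).trans ?_
        gcongr
        exact (ContinuousLinearMap.le_opNNNorm _ _).trans (by gcongr; exact_mod_cast hy₂.le)
    _ = C₁ * C₂ * L * ‖w‖₊ := by ring

variable [FiniteDimensional ℝ E] [T2Space M]

theorem exists_eventually_nnnorm_fderiv_chartRep_le {k : ℕ∞}
    [CovariantDerivative.ContMDiffCovariantDerivative cov k] (y₀ : M) :
    ∃ C : NNReal, ∀ᶠ y in 𝓝 y₀, ∀ (ξ : Π x : M, TangentSpace 𝓘(ℝ, E) x) (L : NNReal),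
      DifferentiableAt ℝ (chartRep y₀ ξ) (extChartAt 𝓘(ℝ, E) y₀ y) → ‖ξ y‖₊ ≤ L →
      (∀ v, ‖cov ξ y v‖₊ ≤ L * ‖v‖₊) →
        ‖fderiv ℝ (chartRep y₀ ξ) (extChartAt 𝓘(ℝ, E) y₀ y)‖₊ ≤ C * L := by
  let b := Module.finBasis ℝ E
  obtain ⟨C₁, h_rep⟩ := exists_eventually_nnnorm_chartRep_le (M := M) (E := E) y₀
  obtain ⟨C₂, h_cov⟩ := exists_eventually_nnnorm_covInChart_le cov y₀
  obtain ⟨C₃, h_christoffel⟩ := exists_eventually_norm_christoffel_le cov b (k := k) y₀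
  refine ⟨C₂ + C₃ * C₁, ?_⟩
  filter_upwards [h_rep, h_cov, h_christoffel, chart_source_mem_nhds E y₀]
    with y hy_rep hy_cov hy_christoffel hy_source ξ L h_diff hL h_cov_le
  rw [fderiv_chartRep cov b hy_source h_diff, add_mul]
  refine (nnnorm_sub_le _ _).trans (add_le_add (hy_cov ξ L h_cov_le) ?_)
  refine (hy_christoffel _ : _ ≤ C₃ * ‖chartRep y₀ ξ (extChartAt 𝓘(ℝ, E) y₀ y)‖₊).trans ?_
  rw [mul_assoc]
  gcongr
  exact (hy_rep ξ).trans (by gcongr)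

theorem hasChartEstimates {k : ℕ∞} [CovariantDerivative.ContMDiffCovariantDerivative cov k] :
    HasChartEstimates cov := by
  intro y₀
  obtain ⟨C₁, h_rep⟩ := exists_eventually_nnnorm_chartRep_le (M := M) (E := E) y₀
  obtain ⟨C₂, h_fderiv⟩ := exists_eventually_nnnorm_fderiv_chartRep_le cov (k := k) y₀
  obtain ⟨r, hr, h_target, h_ball⟩ := exists_forall_mem_chartBall (E := E) (h_rep.and h_fderiv)
  have hr_target := (Metric.closedBall_subset_closedBall (by linarith)).trans h_target
  -- The summand `1` makes the bound infinite where the seminorm is.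
  refine ⟨r, C₁ + C₂ + 1, hr, h_target, fun ξ u hu => ?_, fun ξ hξ u hu v hv => ?_⟩
  · have hy := symm_mem_chartBall hu (hr_target hu)
    have h_le := (h_ball _ hy).1 ξ
    rw [(extChartAt 𝓘(ℝ, E) y₀).right_inv (hr_target hu)] at h_le
    calc ‖chartRep y₀ ξ u‖ₑ
        ≤ C₁ * ‖ξ ((extChartAt 𝓘(ℝ, E) y₀).symm u)‖ₑ := by
          simpa only [enorm, ← ENNReal.coe_mul] using ENNReal.coe_le_coe.2 h_le
      _ ≤ (C₁ + C₂ + 1 : NNReal) * lipSeminorm cov (chartBall E y₀ r) ξ := by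
        gcongr
        · rw [add_assoc]; exact le_self_add
        · exact enorm_le_lipSeminorm cov hy ξ
  · rcases eq_or_ne (lipSeminorm cov (chartBall E y₀ r) ξ) ⊤ with h_top | h_fin
    · rcases eq_or_ne u v with rfl | huv
      · simp only [sub_self, enorm_zero, mul_zero, le_refl]
      · rw [h_top, ENNReal.mul_top (by simp), ENNReal.top_mul (by simpa [sub_eq_zero] using huv)]
        exact le_top
    obtain ⟨L, hL⟩ : ∃ L : NNReal, lipSeminorm cov (chartBall E y₀ r) ξ = L :=
      ⟨_, (ENNReal.coe_toNNReal h_fin).symm⟩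
    have h_lip : LipschitzOnWith (C₂ * L) (chartRep y₀ ξ) _ :=
      hξ.lipschitzOnWith_chartRep hr.ne' hr_target fun y hy h_diff =>
        (h_ball y hy).2 ξ L h_diff
          (ENNReal.coe_le_coe.1 ((enorm_le_lipSeminorm cov hy ξ).trans hL.le))
          (nnnorm_cov_apply_le cov hy (isDifferentiableAt_of_chartRep hy.1 h_diff) hL.le)
    have h_le := h_lip hu hv
    rw [edist_eq_enorm_sub, edist_eq_enorm_sub] at h_le
    refine h_le.trans ?_
    rw [hL, ← ENNReal.coe_mul]
    gcongr
    exact le_add_right le_add_self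

end ChartEstimate

section Curves

theorem ae_mem_nhds_of_ordConnected {J : Set ℝ} (hJ : J.OrdConnected) :
    ∀ᵐ t, t ∈ J → J ∈ 𝓝 t := by
  filter_upwards [measure_eq_zero_iff_ae_notMem.1 (hJ.convex.addHaar_frontier volume)]
    with t ht htJ
  exact mem_interior_iff_mem_nhds.1 (by_contra fun h => ht ⟨subset_closure htJ, h⟩)

variable {E : Type*} [NormedAddCommGroup E] [NormedSpace ℝ E]
  {M : Type*} [TopologicalSpace M] [ChartedSpace E M]
  {T J J' : Set ℝ} {ξ : ℝ → Π x : M, TangentSpace 𝓘(ℝ, E) x} {γ γ' : ℝ → M} {a b c : ℝ}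

theorem isLocallyAC_uIcc (h : ∀ f : M → ℝ, ContMDiff 𝓘(ℝ, E) 𝓘(ℝ, ℝ) ∞ f →
    AbsolutelyContinuousOnInterval (f ∘ γ) a b) : IsLocallyAC E γ (uIcc a b) :=
  fun f hf _ hs _ ht => (h f hf).mono (uIcc_subset_uIcc hs ht)

theorem IsLocallyAC.continuousOn_Icc [FiniteDimensional ℝ E] [IsManifold 𝓘(ℝ, E) ∞ M] [T2Space M]
    (hγ : IsLocallyAC E γ (Icc a b)) : ContinuousOn γ (Icc a b) := by
  intro t ht U hU
  obtain ⟨ψ, -, hψ⟩ := (SmoothBumpFunction.nhds_basis_support (I := 𝓘(ℝ, E)) hU).mem_iff.1 hU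
  have hab : a ≤ b := ht.1.trans ht.2
  have h_cont := (hγ ψ ψ.contMDiff a (left_mem_Icc.2 hab) b (right_mem_Icc.2 hab)).continuousOn
  rw [uIcc_of_le hab] at h_cont
  have h_pos : ∀ᶠ s in 𝓝[Icc a b] t, 0 < ψ (γ s) :=
    (h_cont t ht).eventually_const_lt (by simp only [Function.comp_apply, ψ.eq_one, zero_lt_one])
  exact h_pos.mono fun s hs => hψ hs.ne'

namespace IsIntegralCurve

theorem mono (hγ : IsIntegralCurve T ξ J γ) (hJ' : J'.OrdConnected) (hsub : J' ⊆ J) :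
    IsIntegralCurve T ξ J' γ where
  ordConnected := hJ'
  subset := hsub.trans hγ.subset
  locallyAC f hf a ha b hb := hγ.locallyAC f hf a (hsub ha) b (hsub hb)
  hasDeriv := (ae_restrict_of_ae_restrict_of_subset hsub hγ.hasDeriv).mono fun _ ht => ht.mono hsub

theorem mono_uIcc (hγ : IsIntegralCurve T ξ J γ) (ha : a ∈ J) (hb : b ∈ J) :
    IsIntegralCurve T ξ (uIcc a b) γ :=
  hγ.mono ordConnected_uIcc (hγ.ordConnected.uIcc_subset ha hb)

theorem congr (hγ : IsIntegralCurve T ξ J γ) (h : EqOn γ' γ J) : IsIntegralCurve T ξ J γ' where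
  ordConnected := hγ.ordConnected
  subset := hγ.subset
  locallyAC f hf a ha b hb := by
    have hJ := hγ.ordConnected.uIcc_subset ha hb
    refine absolutelyContinuousOnInterval_of_dist_le (hγ.locallyAC f hf a ha b hb)
      fun s hs t ht => le_of_eq ?_
    simp only [Function.comp_apply, h (hJ hs), h (hJ ht)]
  hasDeriv := by
    filter_upwards [hγ.hasDeriv, ae_restrict_mem hγ.ordConnected.measurableSet] with t ht htJ
    rw [h htJ]
    exact ht.congr_of_eventuallyEq h.eventuallyEq_nhdsWithin (h htJ)

theorem ae_hasMFDerivAt (hγ : IsIntegralCurve T ξ J γ) : ∀ᵐ t, t ∈ J →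
    HasMFDerivAt 𝓘(ℝ, ℝ) 𝓘(ℝ, E) γ t ((1 : ℝ →L[ℝ] ℝ).smulRight (ξ t (γ t))) := by
  filter_upwards [(ae_restrict_iff' hγ.ordConnected.measurableSet).1 hγ.hasDeriv,
    ae_mem_nhds_of_ordConnected hγ.ordConnected] with t ht hJ htJ
  exact (ht htJ).hasMFDerivAt (hJ htJ)

theorem uIcc_union (hab : IsIntegralCurve T ξ (uIcc a b) γ)
    (hbc : IsIntegralCurve T ξ (uIcc b c) γ) : IsIntegralCurve T ξ (uIcc a c) γ where
  ordConnected := ordConnected_uIcc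
  subset := uIcc_subset_uIcc_union_uIcc.trans (union_subset hab.subset hbc.subset)
  locallyAC := isLocallyAC_uIcc fun f hf => absolutelyContinuousOnInterval_trans
    (hab.locallyAC f hf a left_mem_uIcc b right_mem_uIcc)
    (hbc.locallyAC f hf b left_mem_uIcc c right_mem_uIcc)
  hasDeriv := by
    refine (ae_restrict_iff' measurableSet_uIcc).2 ?_
    filter_upwards [hab.ae_hasMFDerivAt, hbc.ae_hasMFDerivAt] with t h_ab h_bc ht
    exact ((uIcc_subset_uIcc_union_uIcc ht).elim h_ab h_bc).hasMFDerivWithinAt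

theorem exists_concat {β₁ β₂ : ℝ → M} (hb : b ∈ uIcc a c)
    (h₁ : IsIntegralCurve T ξ (uIcc a b) β₁) (h₂ : IsIntegralCurve T ξ (uIcc b c) β₂)
    (h_eq : β₁ b = β₂ b) :
    ∃ β : ℝ → M, IsIntegralCurve T ξ (uIcc a c) β ∧ EqOn β β₁ (uIcc a b) ∧
      EqOn β β₂ (uIcc b c) := by
  classical
  let β := (uIcc a b).piecewise β₁ β₂
  have h_eqOn₁ : EqOn β β₁ (uIcc a b) := piecewise_eqOn _ _ _
  have h_eqOn₂ : EqOn β β₂ (uIcc b c) := fun t ht => by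
    by_cases ht' : t ∈ uIcc a b
    · obtain rfl : t = b := by grind [mem_uIcc]
      rw [h_eqOn₁ ht', h_eq]
    · exact piecewise_eq_of_notMem _ _ _ ht'
  exact ⟨β, (h₁.congr h_eqOn₁).uIcc_union (h₂.congr h_eqOn₂), h_eqOn₁, h_eqOn₂⟩

end IsIntegralCurve

end Curves

section ChartCurves

variable {E : Type*} [NormedAddCommGroup E] [NormedSpace ℝ E]
  {M : Type*} [TopologicalSpace M] [ChartedSpace E M] [IsManifold 𝓘(ℝ, E) ∞ M] {y₀ : M} {t : ℝ}

theorem hasDerivAt_extChartAt_comp {γ : ℝ → M} {ξ : Π x : M, TangentSpace 𝓘(ℝ, E) x}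
    (hγ : HasMFDerivAt 𝓘(ℝ, ℝ) 𝓘(ℝ, E) γ t ((1 : ℝ →L[ℝ] ℝ).smulRight (ξ (γ t))))
    (ht : γ t ∈ (chartAt E y₀).source) :
    HasDerivAt (fun s => extChartAt 𝓘(ℝ, E) y₀ (γ s))
      (chartRep y₀ ξ (extChartAt 𝓘(ℝ, E) y₀ (γ t))) t := by
  have ht' : γ t ∈ (extChartAt 𝓘(ℝ, E) y₀).source := by rwa [extChartAt_source]
  let A : E →L[ℝ] E := mfderiv 𝓘(ℝ, E) 𝓘(ℝ, E) (extChartAt 𝓘(ℝ, E) y₀) (γ t)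
  have hA : chartRep y₀ ξ (extChartAt 𝓘(ℝ, E) y₀ (γ t)) = A (ξ (γ t)) := by
    rw [chartRep_eq_continuousLinearMapAt ξ ((extChartAt 𝓘(ℝ, E) y₀).map_source ht'),
      (extChartAt 𝓘(ℝ, E) y₀).left_inv ht',
      TangentBundle.continuousLinearMapAt_trivializationAt ht]
    rfl
  have h_comp := ((mdifferentiableAt_extChartAt ht).hasMFDerivAt.comp t hγ).hasFDerivAt
  let v : E := ξ (γ t)
  have h_deriv : HasFDerivAt (fun s => extChartAt 𝓘(ℝ, E) y₀ (γ s))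
      ((1 : ℝ →L[ℝ] ℝ).smulRight (A v)) t :=
    h_comp.congr_fderiv (ContinuousLinearMap.ext fun q : ℝ => map_smul A q v)
  rw [hA]
  simpa using h_deriv.hasDerivAt

theorem hasMFDerivAt_extChartAt_symm_comp {u : ℝ → E} {ξ : Π x : M, TangentSpace 𝓘(ℝ, E) x}
    (hu : HasDerivAt u (chartRep y₀ ξ (u t)) t) (ht : u t ∈ (extChartAt 𝓘(ℝ, E) y₀).target) :
    HasMFDerivAt 𝓘(ℝ, ℝ) 𝓘(ℝ, E) (fun s => (extChartAt 𝓘(ℝ, E) y₀).symm (u s)) t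
      ((1 : ℝ →L[ℝ] ℝ).smulRight (ξ ((extChartAt 𝓘(ℝ, E) y₀).symm (u t)))) := by
  have ht' := extChartAt_symm_mem_chartAt_source ht
  let A : E →L[ℝ] E := mfderiv 𝓘(ℝ, E) 𝓘(ℝ, E) (extChartAt 𝓘(ℝ, E) y₀).symm (u t)
  have hA : A (chartRep y₀ ξ (u t)) = ξ ((extChartAt 𝓘(ℝ, E) y₀).symm (u t)) := by
    have h_symmL := (trivializationAt E (TangentSpace 𝓘(ℝ, E) : M → Type _)
      y₀).symmL_continuousLinearMapAt (R := ℝ) ht' (ξ ((extChartAt 𝓘(ℝ, E) y₀).symm (u t)))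
    rwa [TangentBundle.symmL_trivializationAt ht', ← chartRep_eq_continuousLinearMapAt ξ ht,
      (extChartAt 𝓘(ℝ, E) y₀).right_inv ht, modelWithCornersSelf_coe, range_id,
      mfderivWithin_univ] at h_symmL
  have h_diff : MDifferentiableAt 𝓘(ℝ, E) 𝓘(ℝ, E) (extChartAt 𝓘(ℝ, E) y₀).symm (u t) :=
    ((contMDiffOn_extChartAt_symm (n := ∞) y₀).contMDiffAt
      ((isOpen_extChartAt_target y₀).mem_nhds ht)).mdifferentiableAt (by simp)
  refine (h_diff.hasMFDerivAt.comp t hu.hasFDerivAt.hasMFDerivAt).congr_mfderiv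
    (ContinuousLinearMap.ext fun q : ℝ => ?_)
  exact (map_smul A q _).trans (congrArg (q • ·) hA)

variable {T J : Set ℝ} {ξ : ℝ → Π x : M, TangentSpace 𝓘(ℝ, E) x} {r : ℝ} [FiniteDimensional ℝ E]

theorem IsLocallyAC.absolutelyContinuousOnInterval_clm_extChartAt [T2Space M] {γ : ℝ → M}
    (hγ : IsLocallyAC E γ J) (hJ : J.OrdConnected) (hr : 0 < r)
    (h_target : Metric.closedBall (extChartAt 𝓘(ℝ, E) y₀ y₀) (2 * r) ⊆
      (extChartAt 𝓘(ℝ, E) y₀).target)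
    (hγ_ball : MapsTo γ J (chartBall E y₀ r)) (ℓ : E →L[ℝ] ℝ) {s t : ℝ} (hs : s ∈ J) (ht : t ∈ J) :
    AbsolutelyContinuousOnInterval (fun τ => ℓ (extChartAt 𝓘(ℝ, E) y₀ (γ τ))) s t := by
  let ψ : SmoothBumpFunction 𝓘(ℝ, E) y₀ :=
    { rIn := r
      rOut := 2 * r
      rIn_pos := hr
      rIn_lt_rOut := by linarith
      closedBall_subset := inter_subset_left.trans h_target }
  have hψ : ∀ τ ∈ uIcc s t, ψ (γ τ) = 1 := fun τ hτ =>
    have h := hγ_ball (hJ.uIcc_subset hs ht hτ)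
    ψ.one_of_dist_le h.1 h.2
  have h_smooth : ContMDiff 𝓘(ℝ, E) 𝓘(ℝ, ℝ) ∞ (fun x => ψ x • ℓ (extChartAt 𝓘(ℝ, E) y₀ x)) :=
    ψ.contMDiff_smul (ℓ.contDiff.contMDiff.comp_contMDiffOn (contMDiffOn_extChartAt (x := y₀)))
  refine absolutelyContinuousOnInterval_of_dist_le (hγ _ h_smooth s hs t ht)
    fun τ hτ τ' hτ' => le_of_eq ?_
  simp only [Function.comp_apply, hψ τ hτ, hψ τ' hτ', one_smul]

theorem IsIntegralCurve.continuousOn_extChartAt_comp [T2Space M] {a b : ℝ} {γ : ℝ → M}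
    (hγ : IsIntegralCurve T ξ (Icc a b) γ)
    (hγ_ball : MapsTo γ (Icc a b) (chartBall E y₀ r)) :
    ContinuousOn (fun t => extChartAt 𝓘(ℝ, E) y₀ (γ t)) (Icc a b) :=
  (continuousOn_extChartAt y₀).comp hγ.locallyAC.continuousOn_Icc fun _ ht => by
    simpa only [extChartAt_source] using (hγ_ball ht).1

theorem IsIntegralCurve.extChartAt_eq_add_integral [T2Space M] {γ : ℝ → M}
    (hγ : IsIntegralCurve T ξ J γ) (hr : 0 < r)
    (h_target : Metric.closedBall (extChartAt 𝓘(ℝ, E) y₀ y₀) (2 * r) ⊆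
      (extChartAt 𝓘(ℝ, E) y₀).target)
    (hγ_ball : MapsTo γ J (chartBall E y₀ r))
    (h_int : IntegrableOn (fun t => chartRep y₀ (ξ t) (extChartAt 𝓘(ℝ, E) y₀ (γ t))) J)
    {s t : ℝ} (hs : s ∈ J) (ht : t ∈ J) :
    extChartAt 𝓘(ℝ, E) y₀ (γ t) = extChartAt 𝓘(ℝ, E) y₀ (γ s) +
      ∫ τ in s..t, chartRep y₀ (ξ τ) (extChartAt 𝓘(ℝ, E) y₀ (γ τ)) := by
  have hst := hγ.ordConnected.uIcc_subset hs ht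
  rw [← sub_eq_iff_eq_add']
  refine (SeparatingDual.eq_iff_forall_dual_eq (R := ℝ)).2 fun ℓ => ?_
  have h_ac := hγ.locallyAC.absolutelyContinuousOnInterval_clm_extChartAt hγ.ordConnected hr
    h_target hγ_ball ℓ hs ht
  rw [map_sub, ← h_ac.integral_deriv_eq_sub, ← ContinuousLinearMap.intervalIntegral_comp_comm ℓ
    (h_int.mono_set hst).intervalIntegrable]
  refine intervalIntegral.integral_congr_ae ?_
  filter_upwards [hγ.ae_hasMFDerivAt] with τ hτ hτ_mem
  have hτJ := hst (uIoc_subset_uIcc hτ_mem)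
  exact (ℓ.hasFDerivAt.comp_hasDerivAt τ
    (hasDerivAt_extChartAt_comp (hτ hτJ) (hγ_ball hτJ).1)).deriv

theorem isLocallyAC_extChartAt_symm_comp {a b : ℝ} {u g : ℝ → E}
    (h_target : Metric.closedBall (extChartAt 𝓘(ℝ, E) y₀ y₀) r ⊆ (extChartAt 𝓘(ℝ, E) y₀).target)
    (hu_ball : MapsTo u (uIcc a b) (Metric.closedBall (extChartAt 𝓘(ℝ, E) y₀ y₀) r))
    (hg : IntervalIntegrable g volume a b)
    (hu : ∀ t ∈ uIcc a b, ∀ t' ∈ uIcc a b, u t' - u t = ∫ τ in t..t', g τ) :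
    IsLocallyAC E (fun t => (extChartAt 𝓘(ℝ, E) y₀).symm (u t)) (uIcc a b) := by
  have := FiniteDimensional.proper_real E
  refine isLocallyAC_uIcc fun f hf => ?_
  have h_smooth : ContDiffOn ℝ ∞ (f ∘ (extChartAt 𝓘(ℝ, E) y₀).symm)
      (Metric.closedBall (extChartAt 𝓘(ℝ, E) y₀ y₀) r) :=
    contMDiffOn_iff_contDiffOn.1
      (hf.comp_contMDiffOn ((contMDiffOn_extChartAt_symm y₀).mono h_target))
  obtain ⟨C, hC⟩ := h_smooth.exists_lipschitzOnWith (by simp) (convex_closedBall _ _)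
    (isCompact_closedBall _ _)
  have h_ac := absolutelyContinuousOnInterval_comp_primitive hg hu hC hu_ball
  rwa [Function.comp_assoc] at h_ac

theorem isIntegralCurve_extChartAt_symm_comp {a b : ℝ} (hT : Icc a b ⊆ T)
    (h_target : Metric.closedBall (extChartAt 𝓘(ℝ, E) y₀ y₀) r ⊆ (extChartAt 𝓘(ℝ, E) y₀).target)
    {u : ℝ → E} (hu_ball : MapsTo u (Icc a b) (Metric.closedBall (extChartAt 𝓘(ℝ, E) y₀ y₀) r))
    (h_int : IntegrableOn (fun t => chartRep y₀ (ξ t) (u t)) (Icc a b))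
    {s : ℝ} (hs : s ∈ Icc a b) {x : E}
    (hu : ∀ t ∈ Icc a b, u t = x + ∫ τ in s..t, chartRep y₀ (ξ τ) (u τ)) :
    IsIntegralCurve T ξ (Icc a b) (fun t => (extChartAt 𝓘(ℝ, E) y₀).symm (u t)) := by
  have h_uIcc := uIcc_of_le (hs.1.trans hs.2)
  rw [← h_uIcc] at hT hu_ball h_int hs hu ⊢
  have hi {q : ℝ} (hq : q ∈ uIcc a b) :
      IntervalIntegrable (fun t => chartRep y₀ (ξ t) (u t)) volume s q :=
    (h_int.mono_set (uIcc_subset_uIcc hs hq)).intervalIntegrable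
  have h_ac := isLocallyAC_extChartAt_symm_comp h_target hu_ball h_int.intervalIntegrable
    fun t ht t' ht' => by
      rw [hu t ht, hu t' ht', ← intervalIntegral.integral_interval_sub_left (hi ht') (hi ht),
        add_sub_add_left_eq_sub]
  refine ⟨ordConnected_uIcc, hT, h_ac, (ae_restrict_iff' measurableSet_uIcc).2 ?_⟩
  filter_upwards [h_int.intervalIntegrable.ae_hasDerivAt_integral,
    ae_mem_nhds_of_ordConnected (ordConnected_uIcc (a := a) (b := b))] with τ hτ h_nhds hτ_mem
  have h_deriv : HasDerivAt u (chartRep y₀ (ξ τ) (u τ)) τ := by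
    refine ((hτ hτ_mem s hs).const_add x).congr_of_eventuallyEq ?_
    filter_upwards [h_nhds hτ_mem] with q hq using hu q hq
  exact (hasMFDerivAt_extChartAt_symm_comp h_deriv
    (h_target (hu_ball hτ_mem))).hasMFDerivWithinAt

end ChartCurves

section Uniqueness

theorem exists_Icc_mem_nhdsWithin_setLIntegral_le {g : ℝ → ℝ≥0∞} {A B s : ℝ} (hs : s ∈ Icc A B)
    (hg : ∫⁻ t in Icc A B, g t ≠ ⊤) {p : ℝ → Prop} (hp : ∀ᶠ t in 𝓝[Icc A B] s, p t)
    {ε : ℝ≥0∞} (hε : ε ≠ 0) :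
    ∃ a b, s ∈ Icc a b ∧ Icc a b ⊆ Icc A B ∧ Icc a b ∈ 𝓝[Icc A B] s ∧ (∀ t ∈ Icc a b, p t) ∧
      ∫⁻ t in Icc a b, g t ≤ ε := by
  obtain ⟨δ, hδ, h_small⟩ := exists_pos_setLIntegral_lt_of_measure_lt hg hε
  obtain ⟨U, hsU, hU_open, hUδ⟩ :=
    exists_isOpen_lt_of_lt (μ := volume) {s} δ (by simpa only [measure_singleton] using hδ)
  obtain ⟨V, hV, hVp⟩ := mem_nhdsWithin_iff_exists_mem_nhds_inter.1 hp
  obtain ⟨b, c, hs_bc, hbc, hbc_sub⟩ :=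
    exists_Icc_mem_subset_of_mem_nhds (inter_mem (hU_open.mem_nhds (hsU rfl)) hV)
  have h_lt := h_small (Icc b c) <| calc
    volume.restrict (Icc A B) (Icc b c) ≤ volume (Icc b c) := Measure.restrict_apply_le _ _
    _ ≤ volume U := measure_mono fun t ht => (hbc_sub ht).1
    _ < δ := hUδ
  rw [Measure.restrict_restrict measurableSet_Icc, inter_comm] at h_lt
  refine ⟨max A b, min B c, ?_⟩
  rw [← Icc_inter_Icc]
  exact ⟨⟨hs, hs_bc⟩, inter_subset_left, inter_mem_nhdsWithin _ hbc,
    fun t ht => hVp ⟨(hbc_sub ht.2).2, ht.1⟩, h_lt.le⟩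

variable {E : Type*} [NormedAddCommGroup E] [NormedSpace ℝ E] [FiniteDimensional ℝ E]
  {M : Type*} [TopologicalSpace M] [ChartedSpace E M] [IsManifold 𝓘(ℝ, E) ∞ M]
  [RiemannianBundle (fun x : M => TangentSpace 𝓘(ℝ, E) x)]
  {cov : CovariantDerivative 𝓘(ℝ, E) E (TangentSpace 𝓘(ℝ, E) : M → Type _)}
  {T : Set ℝ} {ξ η : ℝ → Π x : M, TangentSpace 𝓘(ℝ, E) x} {y₀ : M} {r : ℝ} {C : NNReal}
  {a b : ℝ} {γ γ₁ γ₂ : ℝ → M}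

namespace IsChartEstimate

theorem lintegral_lt_top (h : IsChartEstimate cov y₀ r C) (hξ : IsLocIntegrablyBounded cov T ξ)
    (hT : Icc a b ⊆ T) :
    ∫⁻ t in Icc a b, C * lipSeminorm cov (chartBall E y₀ r) (ξ t) < ⊤ := by
  rw [lintegral_const_mul' _ _ ENNReal.coe_ne_top]
  exact ENNReal.mul_lt_top ENNReal.coe_lt_top
    (hξ.integrable _ (isCompact_chartBall h.closedBall_subset_target) _ isCompact_Icc hT).2

theorem isCaratheodory (h : IsChartEstimate cov y₀ r C) (hξ : IsLocIntegrablyBounded cov T ξ)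
    (hT : Icc a b ⊆ T) :
    IsCaratheodory (fun t => chartRep y₀ (ξ t))
      (fun t => C * lipSeminorm cov (chartBall E y₀ r) (ξ t))
      (fun t => C * lipSeminorm cov (chartBall E y₀ r) (ξ t))
      (Metric.closedBall (extChartAt 𝓘(ℝ, E) y₀ y₀) r) a b where
  meas u hu := by
    have h_meas := ((trivializationAt E (TangentSpace 𝓘(ℝ, E) : M → Type _)
      y₀).continuousLinearMapAt ℝ
        ((extChartAt 𝓘(ℝ, E) y₀).symm u)).continuous.comp_aestronglyMeasurable
      ((hξ.meas ((extChartAt 𝓘(ℝ, E) y₀).symm u)).mono_measure (Measure.restrict_mono hT le_rfl))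
    exact h_meas.congr (Eventually.of_forall fun t =>
      (chartRep_eq_continuousLinearMapAt (ξ t) (h.closedBall_subset_target hu)).symm)
  cont t ht u hu := ((hξ.lip t (hT ht)).lipschitzNear_chartRep
    (h.closedBall_subset_target hu)).continuousAt.continuousWithinAt
  bound t _ := h.enorm_chartRep_le (ξ t)
  lintegral_bound := h.lintegral_lt_top hξ hT
  lip t ht := h.enorm_chartRep_sub_le (ξ t) (hξ.lip t (hT ht))

theorem isCaratheodory_of_sub (h : IsChartEstimate cov y₀ r C)
    (hξ : IsLocIntegrablyBounded cov T ξ) (hη : IsLocIntegrablyBounded cov T η)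
    (hT : Icc a b ⊆ T) :
    IsCaratheodory (fun t => chartRep y₀ (ξ t))
      (fun t => C * lipSeminorm cov (chartBall E y₀ r) (ξ t))
      (fun t => C * lipSeminorm cov (chartBall E y₀ r) (η t) +
        C * lipSeminorm cov (chartBall E y₀ r) (ξ t - η t))
      (Metric.closedBall (extChartAt 𝓘(ℝ, E) y₀ y₀) r) a b :=
  { h.isCaratheodory hξ hT with
    lip := fun t ht u hu v hv => by
      have h_sub := (hξ.lip t (hT ht)).sub (hη.lip t (hT ht))
      have h_split : chartRep y₀ (ξ t) u - chartRep y₀ (ξ t) v =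
          (chartRep y₀ (η t) u - chartRep y₀ (η t) v) +
            (chartRep y₀ (ξ t - η t) u - chartRep y₀ (ξ t - η t) v) := by
        rw [chartRep_sub _ _ (h.closedBall_subset_target hu),
          chartRep_sub _ _ (h.closedBall_subset_target hv)]
        abel
      rw [h_split, add_mul]
      exact (enorm_add_le _ _).trans (add_le_add
        (h.enorm_chartRep_sub_le _ (hη.lip t (hT ht)) u hu v hv)
        (h.enorm_chartRep_sub_le _ h_sub u hu v hv)) }

end IsChartEstimate

variable [T2Space M]

namespace IsChartEstimate

theorem extChartAt_eq_add_integral (h : IsChartEstimate cov y₀ r C)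
    (hξ : IsLocIntegrablyBounded cov T ξ) (hγ : IsIntegralCurve T ξ (Icc a b) γ)
    (hγ_ball : MapsTo γ (Icc a b) (chartBall E y₀ r)) {s t : ℝ} (hs : s ∈ Icc a b)
    (ht : t ∈ Icc a b) :
    extChartAt 𝓘(ℝ, E) y₀ (γ t) = extChartAt 𝓘(ℝ, E) y₀ (γ s) +
      ∫ τ in s..t, chartRep y₀ (ξ τ) (extChartAt 𝓘(ℝ, E) y₀ (γ τ)) :=
  hγ.extChartAt_eq_add_integral h.pos h.closedBall_subset hγ_ball
    ((h.isCaratheodory hξ hγ.subset).integrableOn_comp (hγ.continuousOn_extChartAt_comp hγ_ball)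
      fun _ ht => (hγ_ball ht).2) hs ht

theorem eqOn_of_isIntegralCurve (h : IsChartEstimate cov y₀ r C)
    (hξ : IsLocIntegrablyBounded cov T ξ) {q : NNReal} (hq : q < 1)
    (hℓ : ∫⁻ t in Icc a b, C * lipSeminorm cov (chartBall E y₀ r) (ξ t) ≤ q)
    (hγ₁ : IsIntegralCurve T ξ (Icc a b) γ₁) (hγ₁_ball : MapsTo γ₁ (Icc a b) (chartBall E y₀ r))
    (hγ₂ : IsIntegralCurve T ξ (Icc a b) γ₂) (hγ₂_ball : MapsTo γ₂ (Icc a b) (chartBall E y₀ r))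
    {s : ℝ} (hs : s ∈ Icc a b) (h_eq : γ₁ s = γ₂ s) : EqOn γ₁ γ₂ (Icc a b) := by
  have h_eqOn := (h.isCaratheodory hξ hγ₁.subset).eqOn_of_integral_eq hq hℓ
    (hγ₁.continuousOn_extChartAt_comp hγ₁_ball) (fun _ ht => (hγ₁_ball ht).2)
    (hγ₂.continuousOn_extChartAt_comp hγ₂_ball) (fun _ ht => (hγ₂_ball ht).2) hs
    (fun _ ht => h.extChartAt_eq_add_integral hξ hγ₁ hγ₁_ball hs ht)
    (fun _ ht => h_eq ▸ h.extChartAt_eq_add_integral hξ hγ₂ hγ₂_ball hs ht)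
  intro t ht
  rw [← symm_extChartAt_of_mem_chartBall (hγ₁_ball ht),
    ← symm_extChartAt_of_mem_chartBall (hγ₂_ball ht)]
  exact congrArg _ (h_eqOn ht)

end IsChartEstimate

namespace IsIntegralCurve

theorem eventually_eq (h : HasChartEstimates cov) (hξ : IsLocIntegrablyBounded cov T ξ)
    (hγ₁ : IsIntegralCurve T ξ (Icc a b) γ₁) (hγ₂ : IsIntegralCurve T ξ (Icc a b) γ₂) {s : ℝ}
    (hs : s ∈ Icc a b) (h_eq : γ₁ s = γ₂ s) : ∀ᶠ t in 𝓝[Icc a b] s, γ₁ t = γ₂ t := by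
  obtain ⟨r, C, h_est⟩ := h (γ₁ s)
  have h_nhds := chartBall_mem_nhds (E := E) (γ₁ s) h_est.pos
  have h_ball : ∀ᶠ t in 𝓝[Icc a b] s,
      γ₁ t ∈ chartBall E (γ₁ s) r ∧ γ₂ t ∈ chartBall E (γ₁ s) r :=
    inter_mem (hγ₁.locallyAC.continuousOn_Icc s hs h_nhds)
      (hγ₂.locallyAC.continuousOn_Icc s hs (h_eq ▸ h_nhds))
  obtain ⟨a', b', hs', h_sub, h_mem, h_ball', h_int⟩ := exists_Icc_mem_nhdsWithin_setLIntegral_le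
    hs (h_est.lintegral_lt_top hξ hγ₁.subset).ne h_ball
    (ε := (1 / 2 : NNReal)) (by norm_num)
  filter_upwards [h_mem] with t ht
  exact h_est.eqOn_of_isIntegralCurve hξ (by norm_num) h_int (hγ₁.mono ordConnected_Icc h_sub)
    (fun t ht => (h_ball' t ht).1) (hγ₂.mono ordConnected_Icc h_sub)
    (fun t ht => (h_ball' t ht).2) hs' h_eq ht

theorem eqOn_Icc (h : HasChartEstimates cov) (hξ : IsLocIntegrablyBounded cov T ξ)
    (hγ₁ : IsIntegralCurve T ξ (Icc a b) γ₁) (hγ₂ : IsIntegralCurve T ξ (Icc a b) γ₂) {s : ℝ}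
    (hs : s ∈ Icc a b) (h_eq : γ₁ s = γ₂ s) : EqOn γ₁ γ₂ (Icc a b) := by
  have h_iff : ∀ s ∈ Icc a b, ∀ᶠ t in 𝓝[Icc a b] s, γ₁ s = γ₂ s ↔ γ₁ t = γ₂ t := fun s hs => by
    by_cases h_eq : γ₁ s = γ₂ s
    · exact (hγ₁.eventually_eq h hξ hγ₂ hs h_eq).mono fun t ht => iff_of_true h_eq ht
    · have h_ne : ∀ᶠ t in 𝓝[Icc a b] s, (γ₁ t, γ₂ t) ∉ diagonal M :=
        ((hγ₁.locallyAC.continuousOn_Icc s hs).prodMk (hγ₂.locallyAC.continuousOn_Icc s hs))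
          (isClosed_diagonal.isOpen_compl.mem_nhds h_eq)
      exact h_ne.mono fun t ht => iff_of_false h_eq ht
  exact fun t ht => (isPreconnected_Icc.induction₂ (fun s t => γ₁ s = γ₂ s ↔ γ₁ t = γ₂ t) h_iff
    (fun _ _ _ _ _ _ => Iff.trans) (fun _ _ _ _ => Iff.symm) hs ht).1 h_eq

theorem apply_eq_apply (h : HasChartEstimates cov) (hξ : IsLocIntegrablyBounded cov T ξ)
    {J₁ J₂ : Set ℝ} (hγ₁ : IsIntegralCurve T ξ J₁ γ₁) (hγ₂ : IsIntegralCurve T ξ J₂ γ₂) {s t : ℝ}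
    (hs₁ : s ∈ J₁) (ht₁ : t ∈ J₁) (hs₂ : s ∈ J₂) (ht₂ : t ∈ J₂) (h_eq : γ₁ s = γ₂ s) :
    γ₁ t = γ₂ t :=
  (hγ₁.mono_uIcc hs₁ ht₁).eqOn_Icc h hξ (hγ₂.mono_uIcc hs₂ ht₂) left_mem_uIcc h_eq right_mem_uIcc

end IsIntegralCurve

end Uniqueness

section ChartNhds

variable {E : Type*} [NormedAddCommGroup E] [NormedSpace ℝ E]
  {M : Type*} [TopologicalSpace M] [ChartedSpace E M] {y₀ y : M}

theorem exists_forall_dist_extChartAt_le_mem (hy : y ∈ (chartAt E y₀).source) {W : Set M}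
    (hW : W ∈ 𝓝 y) : ∃ ρ > 0, ∀ z ∈ (chartAt E y₀).source,
      dist (extChartAt 𝓘(ℝ, E) y₀ z) (extChartAt 𝓘(ℝ, E) y₀ y) ≤ ρ → z ∈ W := by
  rw [← extChartAt_source 𝓘(ℝ, E) y₀] at hy ⊢
  have h_nhds : (extChartAt 𝓘(ℝ, E) y₀).symm ⁻¹' W ∈ 𝓝 (extChartAt 𝓘(ℝ, E) y₀ y) :=
    continuousAt_extChartAt_symm' hy (by rwa [(extChartAt 𝓘(ℝ, E) y₀).left_inv hy])
  obtain ⟨ρ, hρ, h_ball⟩ := Metric.nhds_basis_closedBall.mem_iff.1 h_nhds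
  exact ⟨ρ, hρ, fun z hz h => (extChartAt 𝓘(ℝ, E) y₀).left_inv hz ▸ h_ball h⟩

theorem eventually_dist_extChartAt_le (hy : y ∈ (chartAt E y₀).source) {ρ : ℝ} (hρ : 0 < ρ) :
    ∀ᶠ z in 𝓝 y, z ∈ (chartAt E y₀).source ∧
      dist (extChartAt 𝓘(ℝ, E) y₀ z) (extChartAt 𝓘(ℝ, E) y₀ y) ≤ ρ :=
  inter_mem ((chartAt E y₀).open_source.mem_nhds hy)
    (continuousAt_extChartAt' (by rwa [extChartAt_source]) (Metric.closedBall_mem_nhds _ hρ))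

end ChartNhds

section LocalFlow

variable {E : Type*} [NormedAddCommGroup E] [NormedSpace ℝ E]
  {M : Type*} [TopologicalSpace M] [ChartedSpace E M]

/-- For parameters near `p₀`, integral curves that start near `γ s₁` at time `s₁` exist up to time
`s₂`, arrive there near `γ s₂`, and stay in a common compact set. -/
def HasLocalFlow {P : Type*} [TopologicalSpace P] (T : Set ℝ)
    (X : P → ℝ → Π x : M, TangentSpace 𝓘(ℝ, E) x) (p₀ : P) (γ : ℝ → M) (s₁ s₂ : ℝ) : Prop :=
  ∀ W ∈ 𝓝 (γ s₂), ∃ C : Set M, IsCompact C ∧ ∀ᶠ z in 𝓝 (γ s₁) ×ˢ 𝓝 p₀, ∃ β : ℝ → M,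
    IsIntegralCurve T (X z.2) (uIcc s₁ s₂) β ∧ β s₁ = z.1 ∧ β s₂ ∈ W ∧ MapsTo β (uIcc s₁ s₂) C

variable [IsManifold 𝓘(ℝ, E) ∞ M]
  [RiemannianBundle (fun x : M => TangentSpace 𝓘(ℝ, E) x)]

/-- At `p₀`, the family `X` is continuous for the seminorms `ξ ↦ ∫_S lipSeminorm K (ξ t) dt`. -/
def IsLipContinuousAt {P : Type*} [TopologicalSpace P]
    (cov : CovariantDerivative 𝓘(ℝ, E) E (TangentSpace 𝓘(ℝ, E) : M → Type _)) (T : Set ℝ)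
    (X : P → ℝ → Π x : M, TangentSpace 𝓘(ℝ, E) x) (p₀ : P) : Prop :=
  ∀ K : Set M, IsCompact K → ∀ S : Set ℝ, IsCompact S → S ⊆ T →
    Tendsto (fun p => ∫⁻ t in S, lipSeminorm cov K (X p t - X p₀ t)) (𝓝 p₀) (𝓝 0)

variable {cov : CovariantDerivative 𝓘(ℝ, E) E (TangentSpace 𝓘(ℝ, E) : M → Type _)}
  {T : Set ℝ} {ξ η : ℝ → Π x : M, TangentSpace 𝓘(ℝ, E) x} {a b c : ℝ}

theorem IsChartEstimate.lintegral_enorm_chartRep_sub_le {y₀ : M} {r : ℝ} {C : NNReal}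
    (h : IsChartEstimate cov y₀ r C) {γ : ℝ → M} (hγ : MapsTo γ (Icc a b) (chartBall E y₀ r)) :
    ∫⁻ t in Icc a b, ‖chartRep y₀ (ξ t) (extChartAt 𝓘(ℝ, E) y₀ (γ t)) -
        chartRep y₀ (η t) (extChartAt 𝓘(ℝ, E) y₀ (γ t))‖ₑ ≤
      ∫⁻ t in Icc a b, C * lipSeminorm cov (chartBall E y₀ r) (ξ t - η t) :=
  setLIntegral_mono' measurableSet_Icc fun t ht => by
    rw [← chartRep_sub _ _ (h.closedBall_subset_target (hγ ht).2)]
    exact h.enorm_chartRep_le _ _ (hγ ht).2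

variable [FiniteDimensional ℝ E]

theorem IsChartEstimate.lintegral_add_sub_le {y₀ : M} {r : ℝ} {C κ δ : NNReal}
    (h : IsChartEstimate cov y₀ r C) (hη : IsLocIntegrablyBounded cov T η) (hT : Icc a b ⊆ T)
    (hκ : ∫⁻ t in Icc a b, C * lipSeminorm cov (chartBall E y₀ r) (η t) ≤ κ)
    (hδ : ∫⁻ t in Icc a b, C * lipSeminorm cov (chartBall E y₀ r) (ξ t - η t) ≤ δ) :
    ∫⁻ t in Icc a b, (C * lipSeminorm cov (chartBall E y₀ r) (η t) +
      C * lipSeminorm cov (chartBall E y₀ r) (ξ t - η t)) ≤ (κ + δ : NNReal) := by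
  rw [lintegral_add_left' ((hη.integrable _ (isCompact_chartBall h.closedBall_subset_target) _
    isCompact_Icc hT).1.const_mul _), ENNReal.coe_add]
  exact add_le_add hκ hδ

variable [T2Space M]

theorem IsIntegralCurve.exists_trans (h : HasChartEstimates cov)
    (hξ : IsLocIntegrablyBounded cov T ξ) {β₁ β₂ : ℝ → M}
    (h₁ : IsIntegralCurve T ξ (uIcc a b) β₁) (h₂ : IsIntegralCurve T ξ (uIcc b c) β₂)
    (h_eq : β₁ b = β₂ b) {C₁ C₂ : Set M} (hC₁ : MapsTo β₁ (uIcc a b) C₁)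
    (hC₂ : MapsTo β₂ (uIcc b c) C₂) :
    ∃ β : ℝ → M, IsIntegralCurve T ξ (uIcc a c) β ∧ β a = β₁ a ∧ β c = β₂ c ∧
      MapsTo β (uIcc a c) (C₁ ∪ C₂) := by
  obtain hb | hc | ha : b ∈ uIcc a c ∨ c ∈ uIcc a b ∨ a ∈ uIcc b c := by grind [mem_uIcc]
  · obtain ⟨β, hβ, h_eqOn₁, h_eqOn₂⟩ := exists_concat hb h₁ h₂ h_eq
    refine ⟨β, hβ, h_eqOn₁ left_mem_uIcc, h_eqOn₂ right_mem_uIcc, fun t ht => ?_⟩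
    rcases uIcc_subset_uIcc_union_uIcc ht with ht | ht
    · exact h_eqOn₁ ht ▸ Or.inl (hC₁ ht)
    · exact h_eqOn₂ ht ▸ Or.inr (hC₂ ht)
  · have h_sub := uIcc_subset_uIcc_left hc
    exact ⟨β₁, h₁.mono ordConnected_uIcc h_sub, rfl,
      h₁.apply_eq_apply h hξ h₂ right_mem_uIcc hc left_mem_uIcc right_mem_uIcc h_eq,
      fun t ht => Or.inl (hC₁ (h_sub ht))⟩
  · have h_sub := uIcc_subset_uIcc_right ha
    exact ⟨β₂, h₂.mono ordConnected_uIcc h_sub,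
      h₂.apply_eq_apply h hξ h₁ left_mem_uIcc ha right_mem_uIcc left_mem_uIcc h_eq.symm, rfl,
      fun t ht => Or.inr (hC₂ (h_sub ht))⟩

theorem IsChartEstimate.exists_isIntegralCurve_near {y₀ : M} {r : ℝ} {C : NNReal}
    (h : IsChartEstimate cov y₀ r C) (hξ : IsLocIntegrablyBounded cov T ξ)
    (hη : IsLocIntegrablyBounded cov T η) {γ : ℝ → M} (hγ : IsIntegralCurve T η (Icc a b) γ)
    (hγ_ball : MapsTo γ (Icc a b) (chartBall E y₀ (r / 2))) {κ δ ρ : NNReal}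
    (hκ : ∫⁻ t in Icc a b, C * lipSeminorm cov (chartBall E y₀ r) (η t) ≤ κ)
    (hδ : ∫⁻ t in Icc a b, C * lipSeminorm cov (chartBall E y₀ r) (ξ t - η t) ≤ δ)
    (hq : κ + δ < 1) (hρ : ρ ≤ r / 2) {s : ℝ} (hs : s ∈ Icc a b) {x : M}
    (hx : x ∈ (chartAt E y₀).source)
    (hxγ : dist (extChartAt 𝓘(ℝ, E) y₀ x) (extChartAt 𝓘(ℝ, E) y₀ (γ s)) + δ ≤
      (1 - (κ + δ)) * ρ) :
    ∃ β : ℝ → M, IsIntegralCurve T ξ (Icc a b) β ∧ β s = x ∧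
      MapsTo β (Icc a b) (chartBall E y₀ r) ∧ ∀ t ∈ Icc a b,
        dist (extChartAt 𝓘(ℝ, E) y₀ (β t)) (extChartAt 𝓘(ℝ, E) y₀ (γ t)) ≤ ρ := by
  have := FiniteDimensional.complete ℝ E
  have h_target := h.closedBall_subset_target
  have hγ_ball' : MapsTo γ (Icc a b) (chartBall E y₀ r) :=
    hγ_ball.mono_right (chartBall_mono (half_le_self h.pos.le))
  have hγ_maps : MapsTo (fun t => extChartAt 𝓘(ℝ, E) y₀ (γ t)) (Icc a b)
      (Metric.closedBall (extChartAt 𝓘(ℝ, E) y₀ y₀) r) := fun t ht => (hγ_ball' ht).2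
  have hγ_cont := hγ.continuousOn_extChartAt_comp hγ_ball'
  have h_tube : ∀ t ∈ Icc a b, Metric.closedBall (extChartAt 𝓘(ℝ, E) y₀ (γ t)) ρ ⊆
      Metric.closedBall (extChartAt 𝓘(ℝ, E) y₀ y₀) r := fun t ht =>
    Metric.closedBall_subset_closedBall' (by linarith [Metric.mem_closedBall.1 (hγ_ball ht).2])
  have h_car := h.isCaratheodory_of_sub hξ hη hγ.subset
  obtain ⟨u, ⟨hu_cont, hu_tube⟩, hu⟩ := h_car.exists_solution_near_of_perturbation hq
    (h.lintegral_add_sub_le hη hγ.subset hκ hδ) hγ_cont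
    ((h.isCaratheodory hη hγ.subset).integrableOn_comp hγ_cont hγ_maps) h_tube hs
    (fun t ht => h.extChartAt_eq_add_integral hη hγ hγ_ball' hs ht)
    ((h.lintegral_enorm_chartRep_sub_le hγ_ball').trans hδ) hxγ
  have hu_ball : MapsTo u (Icc a b) _ := fun t ht => h_tube t ht (hu_tube t ht)
  refine ⟨fun t => (extChartAt 𝓘(ℝ, E) y₀).symm (u t),
    isIntegralCurve_extChartAt_symm_comp hγ.subset h_target hu_ball
      (h_car.integrableOn_comp hu_cont hu_ball) hs hu, ?_,
    fun t ht => symm_mem_chartBall (hu_ball ht) (h_target (hu_ball ht)), fun t ht => ?_⟩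
  · simp only [hu s hs, intervalIntegral.integral_same, add_zero]
    exact (extChartAt 𝓘(ℝ, E) y₀).left_inv (by rwa [extChartAt_source])
  · rw [(extChartAt 𝓘(ℝ, E) y₀).right_inv (h_target (hu_ball ht))]
    exact hu_tube t ht

variable {P : Type*} [TopologicalSpace P] {X : P → ℝ → Π x : M, TangentSpace 𝓘(ℝ, E) x} {p₀ : P}
  {γ : ℝ → M} {s₁ s₂ s₃ : ℝ}

theorem HasLocalFlow.trans (h : HasChartEstimates cov)
    (hX : ∀ p, IsLocIntegrablyBounded cov T (X p)) (h₁₂ : HasLocalFlow T X p₀ γ s₁ s₂)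
    (h₂₃ : HasLocalFlow T X p₀ γ s₂ s₃) : HasLocalFlow T X p₀ γ s₁ s₃ := by
  intro W hW
  obtain ⟨C₂, hC₂, h_flow₂⟩ := h₂₃ W hW
  obtain ⟨px, h_px, pp, h_pp, h_flow₂⟩ := eventually_prod_iff.1 h_flow₂
  obtain ⟨C₁, hC₁, h_flow₁⟩ := h₁₂ {x | px x} h_px
  refine ⟨C₁ ∪ C₂, hC₁.union hC₂, ?_⟩
  filter_upwards [h_flow₁, h_pp.prod_inr _] with z ⟨β₁, hβ₁, h_start, h_px, hβ₁C⟩ h_pp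
  obtain ⟨β₂, hβ₂, h_start₂, h_end, hβ₂C⟩ := h_flow₂ h_px h_pp
  obtain ⟨β, hβ, hβ_start, hβ_end, hβC⟩ :=
    hβ₁.exists_trans h (hX z.2) hβ₂ h_start₂.symm hβ₁C hβ₂C
  exact ⟨β, hβ, hβ_start.trans h_start, hβ_end ▸ h_end, hβC⟩

theorem IsChartEstimate.hasLocalFlow {y₀ : M} {r : ℝ} {C : NNReal}
    (h : IsChartEstimate cov y₀ r C) (hX : ∀ p, IsLocIntegrablyBounded cov T (X p))
    (hp₀ : IsLipContinuousAt cov T X p₀) (hγ : IsIntegralCurve T (X p₀) (Icc a b) γ)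
    (hγ_ball : MapsTo γ (Icc a b) (chartBall E y₀ (r / 2)))
    (h_int : ∫⁻ t in Icc a b, C * lipSeminorm cov (chartBall E y₀ r) (X p₀ t) ≤
      (1 / 2 : NNReal)) (hs₁ : s₁ ∈ Icc a b) (hs₂ : s₂ ∈ Icc a b) :
    HasLocalFlow T X p₀ γ s₁ s₂ := by
  intro W hW
  have h_compact := isCompact_chartBall h.closedBall_subset_target
  obtain ⟨ρ', hρ', hW'⟩ := exists_forall_dist_extChartAt_le_mem (hγ_ball hs₂).1 hW
  obtain ⟨ρ, hρ, hρρ', hρr⟩ : ∃ ρ : NNReal, 0 < ρ ∧ ρ ≤ ρ' ∧ ρ ≤ r / 2 :=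
    ⟨⟨min ρ' (r / 2), (lt_min hρ' (half_pos h.pos)).le⟩, lt_min hρ' (half_pos h.pos),
      min_le_left _ _, min_le_right _ _⟩
  obtain ⟨δ, hδ, hδ4, hδρ⟩ : ∃ δ : NNReal, 0 < δ ∧ δ ≤ 1 / 4 ∧ δ ≤ ρ / 8 :=
    ⟨min (1 / 4) (ρ / 8), by positivity, min_le_left _ _, min_le_right _ _⟩
  have h_pert : ∀ᶠ p in 𝓝 p₀,
      ∫⁻ t in Icc a b, C * lipSeminorm cov (chartBall E y₀ r) (X p t - X p₀ t) ≤ δ := by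
    have h_tendsto := ENNReal.Tendsto.const_mul (a := C)
      (hp₀ _ h_compact _ isCompact_Icc hγ.subset) (Or.inr ENNReal.coe_ne_top)
    simp only [← lintegral_const_mul' _ _ ENNReal.coe_ne_top, mul_zero] at h_tendsto
    exact ENNReal.tendsto_nhds_zero.1 h_tendsto δ (by exact_mod_cast hδ)
  have h_start := eventually_dist_extChartAt_le (hγ_ball hs₁).1
    (show (0 : ℝ) < ρ / 8 by positivity)
  refine ⟨chartBall E y₀ r, h_compact, (h_start.prod_mk h_pert).mono fun z hz => ?_⟩
  rify at hδ4 hδρ hρ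
  obtain ⟨β, hβ, hβ_start, hβ_ball, hβ_dist⟩ := h.exists_isIntegralCurve_near (hX z.2) (hX p₀) hγ
    hγ_ball h_int hz.2 (by rify; linarith) hρr hs₁ hz.1.1 (by
      push_cast
      nlinarith [hz.1.2])
  exact ⟨β, hβ.mono_uIcc hs₁ hs₂, hβ_start,
    hW' _ (hβ_ball hs₂).1 ((hβ_dist s₂ hs₂).trans hρρ'),
    hβ_ball.mono_left (ordConnected_Icc.uIcc_subset hs₁ hs₂)⟩

theorem IsIntegralCurve.eventually_hasLocalFlow (h : HasChartEstimates cov)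
    (hX : ∀ p, IsLocIntegrablyBounded cov T (X p)) (hp₀ : IsLipContinuousAt cov T X p₀)
    (hγ : IsIntegralCurve T (X p₀) (Icc a b) γ) {s : ℝ} (hs : s ∈ Icc a b) :
    ∀ᶠ t in 𝓝[Icc a b] s, HasLocalFlow T X p₀ γ s t ∧ HasLocalFlow T X p₀ γ t s := by
  obtain ⟨r, C, h_est⟩ := h (γ s)
  obtain ⟨a', b', hs', h_sub, h_mem, h_ball, h_int⟩ := exists_Icc_mem_nhdsWithin_setLIntegral_le
    hs (h_est.lintegral_lt_top (hX p₀) hγ.subset).ne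
    (hγ.locallyAC.continuousOn_Icc s hs (chartBall_mem_nhds (E := E) (γ s) (half_pos h_est.pos)))
    (ε := (1 / 2 : NNReal)) (by norm_num)
  have h_flow {s₁ s₂ : ℝ} (hs₁ : s₁ ∈ Icc a' b') (hs₂ : s₂ ∈ Icc a' b') :
      HasLocalFlow T X p₀ γ s₁ s₂ :=
    h_est.hasLocalFlow hX hp₀ (hγ.mono ordConnected_Icc h_sub) h_ball h_int hs₁ hs₂
  filter_upwards [h_mem] with t ht using ⟨h_flow hs' ht, h_flow ht hs'⟩

theorem IsIntegralCurve.hasLocalFlow (h : HasChartEstimates cov)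
    (hX : ∀ p, IsLocIntegrablyBounded cov T (X p)) (hp₀ : IsLipContinuousAt cov T X p₀)
    (hγ : IsIntegralCurve T (X p₀) (uIcc s₁ s₂) γ) : HasLocalFlow T X p₀ γ s₁ s₂ :=
  isPreconnected_uIcc.induction₂' (HasLocalFlow T X p₀ γ)
    (fun _ hs => hγ.eventually_hasLocalFlow h hX hp₀ hs)
    (fun _ _ _ _ _ _ h₁ h₂ => h₁.trans h hX h₂) left_mem_uIcc right_mem_uIcc

end LocalFlow

section RiemannianBundle

theorem isContinuousRiemannianBundle {EB HB B : Type*} [NormedAddCommGroup EB] [NormedSpace ℝ EB]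
    [TopologicalSpace HB] (IB : ModelWithCorners ℝ EB HB) (n : ℕ∞ω) [TopologicalSpace B]
    [ChartedSpace HB B] (F : Type*) [NormedAddCommGroup F] [NormedSpace ℝ F] (V : B → Type*)
    [TopologicalSpace (TotalSpace F V)] [∀ x, NormedAddCommGroup (V x)]
    [∀ x, InnerProductSpace ℝ (V x)] [FiberBundle F V] [VectorBundle ℝ F V]
    [IsContMDiffRiemannianBundle IB n F V] : IsContinuousRiemannianBundle F V :=
  have ⟨g, hg, h_inner⟩ := IsContMDiffRiemannianBundle.exists_contMDiff (IB := IB) (n := n)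
    (F := F) (E := V)
  ⟨g, hg.continuous, h_inner⟩

end RiemannianBundle

section Flow

variable {E : Type*} [NormedAddCommGroup E] [NormedSpace ℝ E]
  {M : Type*} [TopologicalSpace M] [ChartedSpace E M] [IsManifold 𝓘(ℝ, E) ∞ M]
  [RiemannianBundle (fun x : M => TangentSpace 𝓘(ℝ, E) x)]
  {cov : CovariantDerivative 𝓘(ℝ, E) E (TangentSpace 𝓘(ℝ, E) : M → Type _)}
  {P : Type*} {T : Set ℝ} {X : P → ℝ → Π x : M, TangentSpace 𝓘(ℝ, E) x}

theorem IsParamLocIntegrablyBounded.isLipContinuousAt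
    [TopologicalSpace P] (hX : IsParamLocIntegrablyBounded cov T X) (p₀ : P) :
    IsLipContinuousAt cov T X p₀ :=
  fun K hK S hS hST => ENNReal.tendsto_nhds_zero.2 fun ε hε => by
    obtain ⟨O, hO, h_lt⟩ := hX.continuous_seminorm p₀ K hK S hS hST ε hε
    filter_upwards [hO] with p hp using (h_lt p hp).2.le

variable [FiniteDimensional ℝ E] [T2Space M]

theorem IsIntegralCurve.eq_flow (h : HasChartEstimates cov) {p : P}
    (hX : IsLocIntegrablyBounded cov T (X p)) {J : Set ℝ} {γ : ℝ → M}
    (hγ : IsIntegralCurve T (X p) J γ) {t₀ t : ℝ} (ht₀ : t₀ ∈ J) (ht : t ∈ J) :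
    γ t = flow T X t t₀ (γ t₀) p := by
  have h_exists : ∃ (β : ℝ → M) (I : Set ℝ),
      IsIntegralCurve T (X p) I β ∧ t₀ ∈ I ∧ t ∈ I ∧ β t₀ = γ t₀ := ⟨γ, J, hγ, ht₀, ht, rfl⟩
  rw [flow, dif_pos h_exists]
  obtain ⟨I, hβ, ht₀I, htI, h_eq⟩ := h_exists.choose_spec
  exact hγ.apply_eq_apply h hX hβ ht₀ ht ht₀I htI h_eq.symm

variable [TopologicalSpace P] {p₀ : P}

theorem exists_isCompact_eventually_mapsTo_of_mem_existenceInterval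
    (h : HasChartEstimates cov) (hX : ∀ p, IsLocIntegrablyBounded cov T (X p))
    (hp₀ : IsLipContinuousAt cov T X p₀) {K : Set M} (hK : IsCompact K) {t₀ t₁ : ℝ}
    (hD : ∀ x ∈ K, t₁ ∈ existenceInterval T X t₀ x p₀) :
    ∃ C : Set M, IsCompact C ∧ ∀ᶠ p in 𝓝 p₀, ∀ x ∈ K, ∃ β : ℝ → M,
      IsIntegralCurve T (X p) (uIcc t₀ t₁) β ∧ β t₀ = x ∧ MapsTo β (uIcc t₀ t₁) C := by
  refine hK.induction_on ⟨∅, isCompact_empty, Eventually.of_forall (by simp)⟩ ?_ ?_ fun x hx => ?_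
  · rintro K₁ K₂ h_sub ⟨C, hC, h_near⟩
    exact ⟨C, hC, h_near.mono fun p hp x hx => hp x (h_sub hx)⟩
  · rintro K₁ K₂ ⟨C₁, hC₁, h_near₁⟩ ⟨C₂, hC₂, h_near₂⟩
    refine ⟨C₁ ∪ C₂, hC₁.union hC₂, ?_⟩
    filter_upwards [h_near₁, h_near₂] with p hp₁ hp₂ x hx
    rcases hx with hx | hx
    · obtain ⟨β, hβ, h_start, hβC⟩ := hp₁ x hx
      exact ⟨β, hβ, h_start, hβC.mono_right subset_union_left⟩
    · obtain ⟨β, hβ, h_start, hβC⟩ := hp₂ x hx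
      exact ⟨β, hβ, h_start, hβC.mono_right subset_union_right⟩
  · obtain ⟨J, ⟨γ, hγ, ht₀, rfl⟩, ht₁⟩ := hD x hx
    obtain ⟨C, hC, h_flow⟩ := (hγ.mono_uIcc ht₀ ht₁).hasLocalFlow h hX hp₀ univ univ_mem
    obtain ⟨px, h_px, pp, h_pp, h_flow⟩ := eventually_prod_iff.1 h_flow
    refine ⟨{x | px x}, mem_nhdsWithin_of_mem_nhds h_px, C, hC, h_pp.mono fun p hp y hy => ?_⟩
    obtain ⟨β, hβ, h_start, -, hβC⟩ := h_flow hy hp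
    exact ⟨β, hβ, h_start, hβC⟩

end Flow

end LipFlow

end

theorem corollary3p11_general
    {E : Type*} [NormedAddCommGroup E] [NormedSpace ℝ E] [FiniteDimensional ℝ E]
    {M : Type*} [TopologicalSpace M] [ChartedSpace E M] [IsManifold 𝓘(ℝ, E) ∞ M] [T2Space M]
    [RiemannianBundle (fun x : M => TangentSpace 𝓘(ℝ, E) x)]
    [IsContinuousRiemannianBundle E (fun x : M => TangentSpace 𝓘(ℝ, E) x)]
    (cov : CovariantDerivative 𝓘(ℝ, E) E (TangentSpace 𝓘(ℝ, E) : M → Type _))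
    {k : ℕ∞} [CovariantDerivative.ContMDiffCovariantDerivative cov k]
    {P : Type*} [TopologicalSpace P] (T : Set ℝ) (X : P → ℝ → Π x : M, TangentSpace 𝓘(ℝ, E) x)
    (hX : ∀ p, LipFlow.IsLocIntegrablyBounded cov T (X p))
    (K : Set M) (hK : IsCompact K) (t₀ t₁ : ℝ) (p₀ : P)
    (hp₀ : LipFlow.IsLipContinuousAt cov T X p₀)
    (hD : uIcc t₀ t₁ ×ˢ ({t₀} : Set ℝ) ×ˢ K ×ˢ ({p₀} : Set P) ⊆ LipFlow.flowDomain T X) :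
    ∃ O : Set P, IsOpen O ∧ p₀ ∈ O ∧
      uIcc t₀ t₁ ×ˢ ({t₀} : Set ℝ) ×ˢ K ×ˢ O ⊆ LipFlow.flowDomain T X ∧
      (∀ t ∈ uIcc t₀ t₁, ∀ x ∈ K, ∀ p ∈ O, ∀ (J : Set ℝ) (γ : ℝ → M),
        LipFlow.IsIntegralCurve T (X p) J γ → t₀ ∈ J → t ∈ J → γ t₀ = x →
          γ t = LipFlow.flow T X t t₀ x p) ∧
      IsCompact (closure {y : M | ∃ t ∈ uIcc t₀ t₁, ∃ x ∈ K, ∃ p ∈ O,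
        LipFlow.flow T X t t₀ x p = y}) := by
  have h := LipFlow.hasChartEstimates cov (k := k)
  obtain ⟨C, hC, h_near⟩ :=
    LipFlow.exists_isCompact_eventually_mapsTo_of_mem_existenceInterval h hX hp₀ hK
      fun x hx => (@hD (t₁, t₀, x, p₀) ⟨right_mem_uIcc, rfl, hx, rfl⟩).2.2
  obtain ⟨O, h_near, hO, hp₀O⟩ := eventually_nhds_iff.1 h_near
  refine ⟨O, hO, hp₀O, ?_, ?_, hC.closure_of_subset ?_⟩
  · rintro ⟨t, s, x, p⟩ ⟨ht, rfl, hx, hp⟩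
    obtain ⟨β, hβ, h_start, -⟩ := h_near p hp x hx
    exact ⟨hβ.subset ht, hβ.subset left_mem_uIcc, uIcc s t₁, ⟨β, hβ, left_mem_uIcc, h_start⟩, ht⟩
  · rintro t - x - p - J γ hγ ht₀ ht rfl
    exact hγ.eq_flow h (hX p) ht₀ ht
  · rintro _ ⟨t, ht, x, hx, p, hp, rfl⟩
    obtain ⟨β, hβ, rfl, hβC⟩ := h_near p hp x hx
    exact hβ.eq_flow h (hX p) left_mem_uIcc ht ▸ hβC ht

theorem corollary3p11
    {E : Type*} [NormedAddCommGroup E] [NormedSpace ℝ E] [FiniteDimensional ℝ E]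
    {M : Type*} [TopologicalSpace M] [ChartedSpace E M] [IsManifold 𝓘(ℝ, E) ∞ M]
    [T2Space M] [SecondCountableTopology M] [ConnectedSpace M]
    [RiemannianBundle (fun x : M => TangentSpace 𝓘(ℝ, E) x)]
    [IsContMDiffRiemannianBundle 𝓘(ℝ, E) ∞ E (fun x : M => TangentSpace 𝓘(ℝ, E) x)]
    (cov : CovariantDerivative 𝓘(ℝ, E) E (TangentSpace 𝓘(ℝ, E) : M → Type _))
    [CovariantDerivative.ContMDiffCovariantDerivative cov ∞] (hcov : LipFlow.IsMetricConnection cov)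
    {P : Type*} [TopologicalSpace P]
    (T : Set ℝ) (hT : T.OrdConnected)
    (X : P → ℝ → Π x : M, TangentSpace 𝓘(ℝ, E) x)
    (hX : LipFlow.IsParamLocIntegrablyBounded cov T X)
    (K : Set M) (hK : IsCompact K)
    (t₀ t₁ : ℝ) (ht₀ : t₀ ∈ T) (ht₁ : t₁ ∈ T) (p₀ : P)
    (hD : uIcc t₀ t₁ ×ˢ ({t₀} : Set ℝ) ×ˢ K ×ˢ ({p₀} : Set P) ⊆ LipFlow.flowDomain T X) :
    ∃ O : Set P, IsOpen O ∧ p₀ ∈ O ∧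
      -- the flow is defined on `|t₀, t₁| × {t₀} × K × O`
      uIcc t₀ t₁ ×ˢ ({t₀} : Set ℝ) ×ˢ K ×ˢ O ⊆ LipFlow.flowDomain T X ∧
      -- there, its value does not depend on the choice of an integral curve
      (∀ t ∈ uIcc t₀ t₁, ∀ x ∈ K, ∀ p ∈ O, ∀ (J : Set ℝ) (γ : ℝ → M),
        LipFlow.IsIntegralCurve T (X p) J γ → t₀ ∈ J → t ∈ J → γ t₀ = x →
          γ t = LipFlow.flow T X t t₀ x p) ∧
      -- its image is precompact
      IsCompact (closure {y : M | ∃ t ∈ uIcc t₀ t₁, ∃ x ∈ K, ∃ p ∈ O,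
        LipFlow.flow T X t t₀ x p = y}) :=
  have := LipFlow.isContinuousRiemannianBundle 𝓘(ℝ, E) ∞ E
    (fun x : M => TangentSpace 𝓘(ℝ, E) x)
  corollary3p11_general cov (k := ⊤) T X hX.locIntegrablyBounded K hK t₀ t₁ p₀
    (hX.isLipContinuousAt p₀) hD
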